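/- For every $n\ge 17$ there is a constructible Turing complete polynomial vector field $P$ of degree $56$ on $\mathbb R^n$; in particular, such a vector field exists on $\mathbb R^{17}$ and on $\mathbb R^n$ for all large enough $n$. Here a Turing machine $T$ consists of a finite set $Q$ of states containing an initial state $q_0$ and a halting state $q_{halt}$, a finite alphabet $\Sigma=\{0,\dots,s-1\}$ with $s\ge 2$, where $0$ is the blank symbol, and a transition function $\delta:Q\times\Sigma\to Q\times\Sigma\times\{-1,0,1\}$. It acts on pairs $(q,t)\in Q\times\Sigma^{\mathbb Z}$: it stops with output tape $t$ if $q=q_{halt}$; otherwise, if $\delta(q,t_0)=(q',t_0',\varepsilon)$, then $q$ is replaced by $q'$, the symbol $t_0$ by $t_0'$, and the resulting tape $(t_i)_{i\in\mathbb Z}$ by the shifted tape $(t_{i+\varepsilon})_{i\in\mathbb Z}$. It starts in the state $q_0$, and input tapes have finitely many non-blank symbols. The degree of $P=(P_1,\dots,P_n)$, $P_i\in\mathbb R[x_1,\dots,x_n]$, is the largest total degree of the $P_i$. $P$ is constructible if all coefficients of the $P_i$ are computable real numbers. $P$ is Turing complete if there are an algorithm that computes, from a Turing machine $T$ and an input tape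 $t$, a point $p_{T,t}\in\mathbb Q^n$, and an algorithm that computes, from an integer $k\ge 0$ and a finite string $t^*=(t^*_{-k},\dots,t^*_k)$ of symbols, an open set $U_{t^*}\subset\mathbb R^n$ (given as a finite union of sets $\{x: q_1(x)>0,\dots,q_l(x)>0\}$, with polynomials $q_j$ with rational coefficients), such that for all $k$, all $T$, all input tapes $t$ of $T$ and all strings $t^*\in\Sigma^{2k+1}$ of symbols of the alphabet of $T$, the orbit of $P$ through $p_{T,t}$ (the image of the maximal solution of $\dot x=P(x)$, $x(0)=p_{T,t}$) intersects $U_{t^*}$ if and only if $T$ halts with input $t$ and its output tape has the symbols $t^*_{-k},\dots,t^*_k$ in the positions $-k,\dots,k$. -/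

import Mathlib

namespace TuringODE

/-! ## Turing machines -/

/-- A Turing machine: states `Fin states`, alphabet `Fin symbols` with at least two symbols, an
initial and a halting state, and a transition function `δ : Q × Σ → Q × Σ × {-1, 0, 1}`
(Mathlib's `SignType` is `{-1, 0, 1}`). -/
structure TuringMachine where
  states : ℕ
  symbols : ℕ
  two_le_symbols : 2 ≤ symbols
  q₀ : Fin states
  qhalt : Fin states
  δ : Fin states → Fin symbols → Fin states × Fin symbols × SignType

namespace TuringMachine

/-- The blank symbol is the symbol `0`. -/
def blank (T : TuringMachine) : Fin T.symbols :=
  ⟨0, lt_of_lt_of_le Nat.zero_lt_two T.two_le_symbols⟩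

/-- The tapes of a machine are bi-infinite sequences; the head reads position `0`. -/
abbrev Tape (T : TuringMachine) : Type := ℤ → Fin T.symbols

/-- The tapes with finitely many non-blank symbols are presented by two finite words:
`R` is written on positions `0, 1, 2, …` and `L` on positions `-1, -2, -3, …`;
all other cells are blank. -/
def tapeOf (T : TuringMachine) (L R : List (Fin T.symbols)) : T.Tape := fun i =>
  if 0 ≤ i then R.getD i.toNat T.blank else L.getD (-i - 1).toNat T.blank

/-- One step of the algorithm. In the halting state nothing changes. Otherwise, if
`δ(q, t₀) = (q', t₀', ε)`, the state becomes `q'`, the symbol at position `0` is replaced by `t₀'`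
and then the tape is shifted: `ε = 1` is the left shift and `ε = -1` the right shift. -/
def step (T : TuringMachine) (c : Fin T.states × T.Tape) : Fin T.states × T.Tape :=
  if c.1 = T.qhalt then c
  else
    ((T.δ c.1 (c.2 0)).1,
      fun i => Function.update c.2 0 (T.δ c.1 (c.2 0)).2.1 (i + ((T.δ c.1 (c.2 0)).2.2 : ℤ)))

/-- `T` started on the tape `t` halts, and its output tape carries the word
`w = (w₋ₖ, …, wₖ)` on the positions `-k, …, k`. -/
def HaltsWith (T : TuringMachine) (t : T.Tape) (k : ℕ)
    (w : Fin (2 * k + 1) → Fin T.symbols) : Prop :=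
  ∃ j : ℕ, (T.step^[j] (T.q₀, t)).1 = T.qhalt ∧
    ∀ i : Fin (2 * k + 1), (T.step^[j] (T.q₀, t)).2 ((i : ℤ) - (k : ℤ)) = w i

/-- Finite descriptions of Turing machines: number of states, number of symbols, initial state,
halting state, and the table of the transition function (a list of rows, one for each state; a row
has one entry for each symbol). -/
abbrev Code : Type := ℕ × ℕ × ℕ × ℕ × List (List (ℕ × ℕ × ℕ))

/-- The shifts `-1, 0, 1` are written as `0, 1, 2` in the table. -/
def shiftCode (ε : SignType) : ℕ := ((ε : ℤ) + 1).toNat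

/-- The description of a Turing machine. -/
def code (T : TuringMachine) : Code :=
  (T.states, T.symbols, (T.q₀ : ℕ), (T.qhalt : ℕ),
    List.ofFn fun q : Fin T.states => List.ofFn fun a : Fin T.symbols =>
      (((T.δ q a).1 : ℕ), ((T.δ q a).2.1 : ℕ), shiftCode (T.δ q a).2.2))

end TuringMachine

/-- A finite word over an alphabet `Fin s`, as a list of natural numbers. -/
def wordCode {s : ℕ} (w : List (Fin s)) : List ℕ := w.map fun a => (a : ℕ)

/-! ## Constructible points, open sets and polynomials -/

/-- Finite descriptions of rational numbers. -/
abbrev RatCode : Type := ℕ × ℕ × ℕ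

/-- `(a, b, d)` describes the rational number `(a - b) / (d + 1)`. -/
noncomputable def ratVal (c : RatCode) : ℝ := ((c.1 : ℝ) - (c.2.1 : ℝ)) / ((c.2.2 : ℝ) + 1)

/-- Finite descriptions of rational points of `ℝⁿ`. -/
abbrev PointCode (n : ℕ) : Type := Fin n → RatCode

/-- The rational point with a given description. -/
noncomputable def pointVal {n : ℕ} (c : PointCode n) : Fin n → ℝ := fun i => ratVal (c i)

/-- Finite descriptions of polynomials in `n` variables with rational coefficients: a list of
monomials, each given by its coefficient and its exponents. -/
abbrev RatPolyCode (n : ℕ) : Type := List (RatCode × (Fin n → ℕ))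

/-- The value of the described polynomial at a point of `ℝⁿ`. -/
noncomputable def ratPolyVal {n : ℕ} (q : RatPolyCode n) (x : Fin n → ℝ) : ℝ :=
  (q.map fun m => ratVal m.1 * ∏ i, x i ^ m.2 i).sum

/-- Finite descriptions of open semialgebraic sets defined over `ℚ`. -/
abbrev OpenCode (n : ℕ) : Type := List (List (RatPolyCode n))

/-- The described open set: a finite union of finite intersections of sets `{q > 0}`, where `q` is
a polynomial with rational coefficients. -/
def openVal {n : ℕ} (U : OpenCode n) : Set (Fin n → ℝ) :=
  {x | ∃ I ∈ U, ∀ q ∈ I, 0 < ratPolyVal q x}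

theorem continuous_ratPolyVal {n : ℕ} (q : RatPolyCode n) : Continuous (ratPolyVal q) := by
  induction q with
  | nil => exact continuous_const
  | cons m q ih =>
    have h : ratPolyVal (m :: q) = fun x => ratVal m.1 * ∏ i, x i ^ m.2 i + ratPolyVal q x := by
      funext x
      simp [ratPolyVal]
    rw [h]
    fun_prop

theorem isOpen_openVal {n : ℕ} (U : OpenCode n) : IsOpen (openVal U) := by
  have h : openVal U = ⋃ I ∈ {I | I ∈ U}, ⋂ q ∈ {q | q ∈ I}, {x | 0 < ratPolyVal q x} := by
    ext x
    simp [openVal]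
  rw [h]
  refine isOpen_biUnion fun I _ => ?_
  exact (List.finite_toSet I).isOpen_biInter fun q _ =>
    isOpen_lt continuous_const (continuous_ratPolyVal q)

/-- Computable real numbers: an algorithm produces, for every `m`, a rational number at distance
at most `2⁻ᵐ`. -/
def IsComputableReal (x : ℝ) : Prop :=
  ∃ f : ℕ → RatCode, Computable f ∧ ∀ m : ℕ, |x - ratVal (f m)| ≤ 1 / 2 ^ m

/-! ## Polynomial vector fields and Turing completeness -/

/-- The vector field on `ℝⁿ` with polynomial components `P₁, …, Pₙ`. -/
noncomputable def polyField {n : ℕ} (P : Fin n → MvPolynomial (Fin n) ℝ) (x : Fin n → ℝ) : Fin n → ℝ :=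
  fun i => MvPolynomial.eval x (P i)

/-- The degree of a polynomial vector field: the largest total degree of its components. -/
def fieldDegree {n : ℕ} (P : Fin n → MvPolynomial (Fin n) ℝ) : ℕ :=
  Finset.univ.sup fun i => (P i).totalDegree

/-- A polynomial vector field is constructible if all its coefficients are computable. -/
def IsConstructible {n : ℕ} (P : Fin n → MvPolynomial (Fin n) ℝ) : Prop :=
  ∀ i m, IsComputableReal ((P i).coeff m)

/-- The orbit of the vector field `X` through `p`: all values of the integral curves of `X`
(defined on open intervals around the time `0`, in both time directions) that start at `p`. -/
def orbit {n : ℕ} (X : (Fin n → ℝ) → (Fin n → ℝ)) (p : Fin n → ℝ) : Set (Fin n → ℝ) :=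
  {x | ∃ (a b : ℝ) (γ : ℝ → Fin n → ℝ), (0 : ℝ) ∈ Set.Ioo a b ∧ γ 0 = p ∧
    IsIntegralCurveOn γ (fun _ => X) (Set.Ioo a b) ∧ ∃ τ ∈ Set.Ioo a b, γ τ = x}

/-- Turing completeness of a vector field `X` on `ℝⁿ`. There are algorithms producing, from a
Turing machine `T` and an input tape, a rational point `p`, and from a finite word `w` an open
semialgebraic set `U` over `ℚ`, such that the orbit of `X` through `p` meets `U` if and only if `T`
halts on that input with an output tape that carries `w` on the positions `-k, …, k`.
The point does not depend on `w`, and the open set depends on `w` only. -/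
def IsTuringComplete {n : ℕ} (X : (Fin n → ℝ) → (Fin n → ℝ)) : Prop :=
  ∃ (p : TuringMachine.Code × List ℕ × List ℕ → PointCode n) (U : List ℕ → OpenCode n),
    Computable p ∧ Computable U ∧
      ∀ (k : ℕ) (T : TuringMachine) (L R : List (Fin T.symbols))
        (w : Fin (2 * k + 1) → Fin T.symbols),
        (orbit X (pointVal (p (T.code, wordCode L, wordCode R))) ∩
            openVal (U (wordCode (List.ofFn w)))).Nonempty ↔
          T.HaltsWith (T.tapeOf L R) k w

end TuringODE

namespace TuringODE

/-!
The vector field consists of a clock, of three planar rotations with the frequencies `1`, `α` and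
`β`, of a constant coordinate that holds the description of the machine and its input, and of one
decoupled equation of degree `56`. Here `β = ∑ 1 / scale i` and `α = ∑ g i / scale i` are computable
lacunary series, and `g` is a computable enumeration of the pairs (machine with input, output word)
for which the machine halts with that output. At the times `2 π (scale k)` the quotient
`sin (α t) / sin (β t)` is almost equal to `g (k + 1)`, and the open sets detect precisely the times
at which such a digit is read.
-/

/-! ## Lacunary real numbers -/

/-! The field does not simulate a machine; it searches a list. All pairs (machine with input, output
word) whose computation halts with that output are enumerated by a primitive recursive function
`haltingList`, and the computable number `α` stores this list in its lacunary expansion. The start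
point records the code `m` of machine and input, the open set records the code `c` of the word, and
along the orbit all entries of the list are compared with `quadPair m c`. This function is a
polynomial, so the comparison is a polynomial inequality.

Write `Q = scale k`. Since the next denominator is `Q ^ 8`, modulo 1 the numbers `Q α` and `Q β` are
almost `g (k + 1) / Q ^ 7` and `1 / Q ^ 7`. At `t = 2 π Q` the quotient `sin (α t) / sin (β t)` is
therefore almost the integer `g (k + 1)` (`digit_of_scale`).

False alarms have to be excluded at all other times. The conditions on `sin t` and `sin (β t)` force
`t` to be close to `2 π q` with an integer `q` for which `β q` is within `1 / (100 q ^ 4)` of an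
integer. A lacunary `β` admits such approximations only for `q = r Q` with `1 ≤ r < Q`
(`exists_scale_of_approx`), and there the factor `r` cancels in the quotient, which still shows the
digit `g (k + 1)` (`abs_sin_sub_digit_mul_sin_lt`).

The degree 56 comes from the decoupled equation `z' = z ^ 56`, started at its rest point 0. -/

/-- The lacunary sequence `2, 2 ^ 8, 2 ^ 64, …` of denominators. -/
def scale : ℕ → ℕ
  | 0 => 2
  | k + 1 => scale k ^ 8

/-- The numerators of the partial sums of `∑ g i / scale i`. -/
def digitNum (g : ℕ → ℕ) : ℕ → ℕ
  | 0 => g 0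
  | k + 1 => digitNum g k * scale k ^ 7 + g (k + 1)

/-- The partial sums of `∑ g i / scale i`. -/
noncomputable def partialSum (g : ℕ → ℕ) (k : ℕ) : ℝ := (digitNum g k : ℝ) / scale k

/-- The real number `∑ g i / scale i`. -/
noncomputable def digitReal (g : ℕ → ℕ) : ℝ := ⨆ k, partialSum g k

/-! ### Growth of the denominators and tails of the series -/

theorem add_two_le_scale (k : ℕ) : k + 2 ≤ scale k := by
  induction k with
  | zero => simp [scale]
  | succ k ih =>
    have h2 : 2 ≤ scale k := by omega
    calc k + 1 + 2 ≤ scale k * 2 := by omega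
      _ ≤ scale k * scale k := Nat.mul_le_mul_left _ h2
      _ = scale k ^ 2 := by ring
      _ ≤ scale k ^ 8 := Nat.pow_le_pow_right (by omega) (by norm_num)

theorem two_le_scale (k : ℕ) : (2 : ℝ) ≤ scale k := by
  have := add_two_le_scale k
  exact_mod_cast (by omega : 2 ≤ scale k)

theorem scale_pos (k : ℕ) : (0 : ℝ) < scale k := by linarith [two_le_scale k]

theorem scale_succ (k : ℕ) : (scale (k + 1) : ℝ) = (scale k : ℝ) ^ 8 := by simp [scale]

theorem scale_eq_two_pow (k : ℕ) : scale k = 2 ^ 8 ^ k := by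
  induction k with
  | zero => simp [scale]
  | succ k ih => rw [scale, ih, ← pow_mul, pow_succ]

theorem partialSum_succ (g : ℕ → ℕ) (k : ℕ) :
    partialSum g (k + 1) = partialSum g k + g (k + 1) / (scale k : ℝ) ^ 8 := by
  have := (scale_pos k).ne'
  simp only [partialSum, digitNum, scale_succ]
  push_cast
  field_simp

theorem monotone_partialSum (g : ℕ → ℕ) : Monotone (partialSum g) := by
  refine monotone_nat_of_le_succ fun k => ?_
  rw [partialSum_succ]
  have := scale_pos k
  have : 0 ≤ (g (k + 1) : ℝ) / (scale k : ℝ) ^ 8 := by positivity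
  linarith

/-- The upper bounds decrease because the next term is at most `Q / Q ^ 8` and the next margin is
only `1 / Q ^ 40`; together they fit into the old margin `1 / Q ^ 5`. With the increasing partial
sums this encloses the limit. -/
theorem antitone_partialSum_add {g : ℕ → ℕ} (hg : ∀ i, g i ≤ i + 1) :
    Antitone fun k => partialSum g k + 1 / (scale k : ℝ) ^ 5 := by
  refine antitone_nat_of_succ_le fun k => ?_
  simp only [partialSum_succ, scale_succ]
  have h2 := two_le_scale k
  have h0 := scale_pos k
  have hk : ((k + 2 : ℕ) : ℝ) ≤ scale k := by exact_mod_cast add_two_le_scale k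
  have hgk : (g (k + 1) : ℝ) ≤ scale k := le_trans (by exact_mod_cast hg (k + 1)) hk
  set Q : ℝ := (scale k : ℝ)
  have e1 : (g (k + 1) : ℝ) / Q ^ 8 ≤ 1 / Q ^ 7 := by
    rw [div_le_div_iff₀ (by positivity) (by positivity)]
    calc (g (k + 1) : ℝ) * Q ^ 7 ≤ Q * Q ^ 7 := by gcongr
      _ = 1 * Q ^ 8 := by ring
  have e2 : 1 / (Q ^ 8) ^ 5 ≤ 1 / Q ^ 7 := by
    rw [← pow_mul]
    exact one_div_le_one_div_of_le (by positivity) (pow_le_pow_right₀ (by linarith) (by norm_num))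
  have e3 : 1 / Q ^ 7 + 1 / Q ^ 7 ≤ 1 / Q ^ 5 := by
    rw [← add_div, div_le_div_iff₀ (by positivity) (by positivity)]
    have : (2 : ℝ) ≤ Q ^ 2 := by nlinarith
    calc (1 + 1) * Q ^ 5 = 2 * Q ^ 5 := by ring
      _ ≤ Q ^ 2 * Q ^ 5 := by gcongr
      _ = 1 * Q ^ 7 := by ring
  linarith

theorem partialSum_le_upper {g : ℕ → ℕ} (hg : ∀ i, g i ≤ i + 1) (j k : ℕ) :
    partialSum g j ≤ partialSum g k + 1 / (scale k : ℝ) ^ 5 := by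
  have h1 := monotone_partialSum g (le_max_left j k)
  have h2 := antitone_partialSum_add hg (le_max_right j k)
  have := scale_pos (max j k)
  have : 0 ≤ 1 / (scale (max j k) : ℝ) ^ 5 := by positivity
  simp only at h2
  linarith

theorem digitReal_le {g : ℕ → ℕ} (hg : ∀ i, g i ≤ i + 1) (k : ℕ) :
    digitReal g ≤ partialSum g k + 1 / (scale k : ℝ) ^ 5 :=
  ciSup_le fun j => partialSum_le_upper hg j k

theorem partialSum_le_digitReal {g : ℕ → ℕ} (hg : ∀ i, g i ≤ i + 1) (k : ℕ) :
    partialSum g k ≤ digitReal g :=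
  le_ciSup ⟨_, fun _ ⟨j, hj⟩ => hj ▸ partialSum_le_upper hg j 0⟩ k

theorem digitReal_nonneg {g : ℕ → ℕ} (hg : ∀ i, g i ≤ i + 1) : 0 ≤ digitReal g :=
  le_trans (by unfold partialSum; positivity) (partialSum_le_digitReal hg 0)

theorem digitReal_le_one {g : ℕ → ℕ} (hg : ∀ i, g i ≤ i + 1) : digitReal g ≤ 1 := by
  have h := digitReal_le hg 0
  have h0 : (g 0 : ℝ) ≤ 1 := by exact_mod_cast hg 0
  simp only [partialSum, digitNum, scale] at h
  norm_num at h
  linarith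

/-- Multiplication by `scale k` reveals, modulo `1`, the digit `g (k + 1)`. -/
theorem exists_scale_mul_digitReal {g : ℕ → ℕ} (hg : ∀ i, g i ≤ i + 1) (k : ℕ) :
    ∃ e : ℝ, 0 ≤ e ∧ e ≤ 1 / (scale k : ℝ) ^ 32 ∧
      scale k * digitReal g = digitNum g k + (g (k + 1) + e) / (scale k : ℝ) ^ 7 := by
  have h1 := partialSum_le_digitReal hg (k + 1)
  have h2 := digitReal_le hg (k + 1)
  rw [partialSum_succ] at h1 h2
  rw [scale_succ] at h2
  have h0 := scale_pos k
  have hN : partialSum g k = digitNum g k / scale k := rfl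
  rw [hN] at h1 h2
  set Q : ℝ := (scale k : ℝ)
  -- The error `e` is the tail after the digit `g (k + 1)`, rescaled by `Q ^ 8`; the tail is at most
  -- `1 / (Q ^ 8) ^ 5`.
  refine ⟨Q ^ 8 * (digitReal g - digitNum g k / Q - g (k + 1) / Q ^ 8), ?_, ?_, ?_⟩
  · exact mul_nonneg (by positivity) (by linarith)
  · calc _ ≤ Q ^ 8 * (1 / (Q ^ 8) ^ 5) := by gcongr; linarith
      _ = 1 / Q ^ 32 := by field_simp
  · field_simp
    ring

/-- Puts the partial sums of `β` in lowest terms, the denominators being powers of 2. -/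
theorem odd_digitNum_one (k : ℕ) : Odd (digitNum (fun _ => 1) k) := by
  cases k with
  | zero => simp [digitNum]
  | succ k =>
    refine Even.add_one (Even.mul_left ?_ _)
    rw [scale_eq_two_pow, ← pow_mul]
    exact (Nat.even_pow.2 ⟨even_two, by positivity⟩)

/-- The very good rational approximations of the lacunary number `∑ 1 / scale i`. -/
theorem exists_scale_of_approx {q : ℕ} (hq : 1 ≤ q) {p : ℤ}
    (h : |digitReal (fun _ => 1) * q - p| < 1 / (100 * (q : ℝ) ^ 4)) :
    ∃ k r : ℕ, 1 ≤ r ∧ r < scale k ∧ q = r * scale k := by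
  have hex : ∃ k, q < scale k ^ 2 := by
    refine ⟨q, ?_⟩
    have := add_two_le_scale q
    nlinarith
  -- The least `k` with `q < scale k ^ 2`: minimality gives `scale (k - 1) ^ 2 ≤ q`, hence `scale k
  -- ≤ q ^ 4`. The factor 2 covers `k = 0`.
  obtain ⟨k, hk, hmin⟩ : ∃ k, q < scale k ^ 2 ∧ scale k ≤ 2 * q ^ 4 := by
    classical
    refine ⟨Nat.find hex, Nat.find_spec hex, ?_⟩
    rcases hk : Nat.find hex with _ | j
    · have : 1 ≤ q ^ 4 := Nat.one_le_pow _ _ hq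
      simp only [scale]
      omega
    · have hj : scale j ^ 2 ≤ q := by
        have := Nat.find_min hex (m := j) (by omega)
        omega
      calc scale (j + 1) = (scale j ^ 2) ^ 4 := by rw [scale, ← pow_mul]
        _ ≤ q ^ 4 := Nat.pow_le_pow_left hj 4
        _ ≤ 2 * q ^ 4 := by omega
  have hdvd : scale k ∣ q := by
    have hcop : Nat.Coprime (scale k) (digitNum (fun _ => 1) k) := by
      rw [scale_eq_two_pow]
      exact Nat.Coprime.pow_left _ (Nat.coprime_two_left.2 (odd_digitNum_one k))
    -- Otherwise the partial sum times `q` is not an integer, so it differs from `p` by at least `1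
    -- / Q`. The approximation error and the tail, multiplied by `Q`, account for at most `1 / 50 +
    -- 1 / 16`.
    by_contra hnd
    obtain ⟨e, he0, he1, he⟩ := exists_scale_mul_digitReal (g := fun _ => 1) (fun i => by omega) k
    have hne : ((q * digitNum (fun _ => 1) k : ℕ) : ℤ) - p * scale k ≠ 0 := by
      intro h0
      apply hnd
      have : (scale k : ℤ) ∣ ((q * digitNum (fun _ => 1) k : ℕ) : ℤ) := ⟨p, by linarith⟩
      exact hcop.dvd_of_dvd_mul_right (Int.natCast_dvd_natCast.1 this)
    have hone : (1 : ℝ) ≤ |(q : ℝ) * digitNum (fun _ => 1) k - p * scale k| := by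
      exact_mod_cast Int.one_le_abs hne
    have h2 := two_le_scale k
    have h0 := scale_pos k
    have hqk : (q : ℝ) ≤ (scale k : ℝ) ^ 2 := by exact_mod_cast hk.le
    have hkq : (scale k : ℝ) ≤ 2 * (q : ℝ) ^ 4 := by exact_mod_cast hmin
    have hq1 : (1 : ℝ) ≤ q := by exact_mod_cast hq
    set Q : ℝ := (scale k : ℝ)
    have hw : (q : ℝ) * ((1 + e) / Q ^ 7) ≤ 1 / 16 := by
      have he2 : e ≤ 1 := he1.trans ((div_le_one (by positivity)).2 (one_le_pow₀ (by linarith)))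
      calc (q : ℝ) * ((1 + e) / Q ^ 7) ≤ Q ^ 2 * ((1 + 1) / Q ^ 7) := by gcongr
        _ = 2 / Q ^ 5 := by field_simp; norm_num
        _ ≤ 2 / 2 ^ 5 := by gcongr
        _ = 1 / 16 := by norm_num
    have hw0 : 0 ≤ (q : ℝ) * ((1 + e) / Q ^ 7) := by positivity
    have hA : Q * |digitReal (fun _ => 1) * q - p| ≤ 1 / 50 := by
      calc Q * |digitReal (fun _ => 1) * q - p| ≤ 2 * (q : ℝ) ^ 4 * (1 / (100 * (q : ℝ) ^ 4)) := by
            gcongr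
        _ = 1 / 50 := by field_simp; norm_num
    have hB : (q : ℝ) * digitNum (fun _ => 1) k - p * Q =
        Q * (digitReal (fun _ => 1) * q - p) - q * ((1 + e) / Q ^ 7) := by
      have : Q * (digitReal (fun _ => 1) * q - p) = q * (Q * digitReal (fun _ => 1)) - p * Q := by
        ring
      rw [this, he]
      push_cast
      ring
    rw [hB] at hone
    have := abs_sub (Q * (digitReal (fun _ => 1) * q - p)) (q * ((1 + e) / Q ^ 7))
    rw [abs_mul, abs_of_pos h0, abs_of_nonneg hw0] at this
    linarith
  obtain ⟨r, hr⟩ := hdvd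
  refine ⟨k, r, ?_, ?_, by rw [hr, mul_comm]⟩
  · rcases Nat.eq_zero_or_pos r with h0 | h0
    · simp [h0] at hr; omega
    · exact h0
  · rw [hr, pow_two] at hk
    exact Nat.lt_of_mul_lt_mul_left hk

/-! ### Computability -/

theorem primrec_pow_const (n : ℕ) : Primrec fun a : ℕ => a ^ n := by
  induction n with
  | zero => simpa using Primrec.const 1
  | succ n ih => exact (Primrec.nat_mul.comp ih Primrec.id).of_eq fun a => (pow_succ a n).symm

theorem computable_digitNum_scale {g : ℕ → ℕ} (hg : Computable g) :
    Computable fun k => (digitNum g k, scale k) := by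
  have hs : Computable₂ fun (_ : ℕ) (p : ℕ × (ℕ × ℕ)) =>
      (p.2.1 * p.2.2 ^ 7 + g (p.1 + 1), p.2.2 ^ 8) := by
    have h1 : Computable fun x : ℕ × (ℕ × (ℕ × ℕ)) => x.2.2.1 :=
      Computable.fst.comp (Computable.snd.comp Computable.snd)
    have h2 : Computable fun x : ℕ × (ℕ × (ℕ × ℕ)) => x.2.2.2 :=
      Computable.snd.comp (Computable.snd.comp Computable.snd)
    have h3 : Computable fun x : ℕ × (ℕ × (ℕ × ℕ)) => g (x.2.1 + 1) :=
      hg.comp (Computable.succ.comp (Computable.fst.comp Computable.snd))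
    exact Computable.pair
      (Primrec.nat_add.to_comp.comp
        (Primrec.nat_mul.to_comp.comp h1 ((primrec_pow_const 7).to_comp.comp h2)) h3)
      ((primrec_pow_const 8).to_comp.comp h2)
  refine (Computable.nat_rec Computable.id (Computable.const (g 0, 2)) hs).of_eq fun k => ?_
  induction k with
  | zero => rfl
  | succ k ih =>
    simp only [id] at ih ⊢
    simp only [ih, digitNum, scale]

theorem isComputableReal_digitReal {g : ℕ → ℕ} (hg : ∀ i, g i ≤ i + 1) (hc : Computable g) :
    IsComputableReal (digitReal g) := by
  refine ⟨fun m => (digitNum g m, 0, scale m - 1), ?_, fun m => ?_⟩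
  · have h := computable_digitNum_scale hc
    exact Computable.pair (Computable.fst.comp h) (Computable.pair (Computable.const 0)
      (Computable.pred.comp (Computable.snd.comp h)))
  · have h1 := partialSum_le_digitReal hg m
    have h2 := digitReal_le hg m
    have h0 := add_two_le_scale m
    have hv : ratVal (digitNum g m, 0, scale m - 1) = partialSum g m := by
      simp only [ratVal, partialSum]
      rw [Nat.cast_sub (by omega)]
      simp
    rw [hv, abs_of_nonneg (by linarith)]
    have h3 : 1 / (scale m : ℝ) ^ 5 ≤ 1 / 2 ^ m := by
      apply one_div_le_one_div_of_le (by positivity)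
      have : m ≤ 8 ^ m * 5 := by
        have := (Nat.lt_pow_self (n := m) (a := 8) (by norm_num)).le
        omega
      rw [scale_eq_two_pow]
      push_cast
      rw [← pow_mul]
      exact pow_le_pow_right₀ (by norm_num) this
    linarith

theorem IsComputableReal.neg {x : ℝ} (h : IsComputableReal x) : IsComputableReal (-x) := by
  obtain ⟨f, hf, hx⟩ := h
  refine ⟨fun m => ((f m).2.1, (f m).1, (f m).2.2), ?_, fun m => ?_⟩
  · exact Computable.pair (Computable.fst.comp (Computable.snd.comp hf))
      (Computable.pair (Computable.fst.comp hf) (Computable.snd.comp (Computable.snd.comp hf)))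
  · have : ratVal ((f m).2.1, (f m).1, (f m).2.2) = -ratVal (f m) := by
      simp only [ratVal]
      ring
    rw [this, ← abs_neg]
    convert hx m using 2
    ring

theorem isComputableReal_natCast (a : ℕ) : IsComputableReal (a : ℝ) :=
  ⟨fun _ => (a, 0, 0), Computable.const _, fun m => by simp [ratVal]⟩


/-! ## Reading the digits off rotations -/

open Real in
theorem abs_sin_sub_le (x : ℝ) : |sin x - x| ≤ |x| ^ 3 / 6 := by
  have key : ∀ y : ℝ, 0 < y → |sin y - y| ≤ |y| ^ 3 / 6 := fun y hy => by
    have h1 := sin_gt_sub_cube hy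
    have h2 := sin_lt hy
    rw [abs_of_pos hy, abs_le]
    have : 0 ≤ y ^ 3 / 6 := by positivity
    constructor <;> linarith
  rcases lt_trichotomy x 0 with h | h | h
  · have := key (-x) (by linarith)
    rw [sin_neg, abs_neg] at this
    rwa [show -sin x - -x = -(sin x - x) by ring, abs_neg] at this
  · simp [h]
  · exact key x h

open Real in
-- A small sine puts `x` near a multiple of `π`; the positive cosine rules out the odd multiples.
-- The bound on `η` is Jordan's inequality together with `π / 2 ≤ 2`.
theorem exists_int_of_cos_pos {x : ℝ} (h : 0 < cos x) :
    ∃ (p : ℤ) (η : ℝ), x = p * (2 * π) + η ∧ |η| ≤ 2 * |sin x| := by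
  have hpi := pi_pos
  have hr := abs_sub_round (x / (2 * π))
  set p := round (x / (2 * π))
  set η := x - p * (2 * π) with hη
  have hle : |η| ≤ π := by
    have : η = (x / (2 * π) - p) * (2 * π) := by rw [hη]; field_simp
    rw [this, abs_mul, abs_of_pos (show 0 < 2 * π by positivity)]
    nlinarith
  have hcos : 0 < cos |η| := by
    rw [cos_abs, hη, cos_sub_int_mul_two_pi]
    exact h
  have hlt : |η| ≤ π / 2 := by
    by_contra hlt
    push Not at hlt
    have := cos_nonpos_of_pi_div_two_le_of_le hlt.le (by linarith)
    linarith
  refine ⟨p, η, by rw [hη]; ring, ?_⟩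
  have hs := mul_abs_le_abs_sin hlt
  rw [hη, sin_sub_int_mul_two_pi, ← hη] at hs
  have h4 := pi_le_four
  have : |η| = π / 2 * (2 / π * |η|) := by field_simp
  rw [this]
  calc π / 2 * (2 / π * |η|) ≤ π / 2 * |sin x| := by gcongr
    _ ≤ 2 * |sin x| := by gcongr; linarith

open Real in
-- As `r` is an integer, `r * digitNum g k` only contributes full turns.
theorem sin_digitReal_mul {g : ℕ → ℕ} (hg : ∀ i, g i ≤ i + 1) (k r : ℕ) (η : ℝ) :
    ∃ e : ℝ, 0 ≤ e ∧ e ≤ 1 / (scale k : ℝ) ^ 32 ∧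
      sin (digitReal g * (2 * π * (r * scale k) + η)) =
        sin (2 * π * r / (scale k : ℝ) ^ 7 * (g (k + 1) + e) + digitReal g * η) := by
  obtain ⟨e, h0, h1, he⟩ := exists_scale_mul_digitReal hg k
  refine ⟨e, h0, h1, ?_⟩
  have : digitReal g * (2 * π * (r * scale k) + η) =
      2 * π * r / (scale k : ℝ) ^ 7 * (g (k + 1) + e) + digitReal g * η +
        (r * digitNum g k : ℕ) * (2 * π) := by
    calc _ = 2 * π * r * (scale k * digitReal g) + digitReal g * η := by ring
      _ = _ := by
        rw [he]
        push_cast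
        ring
  rw [this, sin_add_nat_mul_two_pi]

set_option maxHeartbeats 1000000 in
open Real in
/-- Near the times `2 π r (scale k)`, the quotient of `sin (α t)` and `sin (β t)` is almost equal
to a digit of `α`. -/
theorem abs_sin_sub_digit_mul_sin_lt {g : ℕ → ℕ} (hg : ∀ i, g i ≤ i + 1) {k r : ℕ} (hr : 1 ≤ r)
    (hrk : r < scale k) {t η : ℝ} (ht : t = 2 * π * (r * scale k) + η)
    (ht5 : 5 * (r * scale k : ℝ) ≤ t) (hpos : 0 < sin (digitReal (fun _ => 1) * t))
    (hη : |η| * (4 * t) ≤ sin (digitReal (fun _ => 1) * t))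
    (hsmall : sin (digitReal (fun _ => 1) * t) * t ^ 4 < 1) :
    |sin (digitReal g * t) - g (k + 1) * sin (digitReal (fun _ => 1) * t)| <
      sin (digitReal (fun _ => 1) * t) / 4 := by
  have h1g : ∀ i, (fun _ : ℕ => 1) i ≤ i + 1 := fun i => by simp
  obtain ⟨ea, ha0, ha1, hea⟩ := sin_digitReal_mul hg k r η
  obtain ⟨eb, hb0, hb1, heb⟩ := sin_digitReal_mul h1g k r η
  rw [← ht] at hea heb
  have hα0 := digitReal_nonneg hg
  have hα1 := digitReal_le_one hg
  have hβ0 := digitReal_nonneg h1g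
  have hβ1 := digitReal_le_one h1g
  have hQ2 := two_le_scale k
  have hgQ : (g (k + 1) : ℝ) ≤ scale k :=
    by exact_mod_cast (hg (k + 1)).trans (add_two_le_scale k)
  have hg0 : (0 : ℝ) ≤ g (k + 1) := by positivity
  have hrQ : (r : ℝ) ≤ scale k := by exact_mod_cast hrk.le
  have hr1 : (1 : ℝ) ≤ r := by exact_mod_cast hr
  -- From here on only inequalities between real numbers matter.
  generalize digitReal g = α at *
  generalize digitReal (fun _ => 1) = β at *
  generalize sin (β * t) = b at *
  generalize sin (α * t) = a at *
  generalize (g (k + 1) : ℝ) = G at *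
  generalize (scale k : ℝ) = Q at *
  generalize (r : ℝ) = R at *
  push_cast at heb
  have hpi := pi_pos
  have hpi4 : π < 3.15 := pi_lt_d2
  have htQ : 5 * Q ≤ t := by nlinarith
  -- sizes
  have hX0 : 0 ≤ 2 * π * R / Q ^ 7 := by positivity
  have hX1 : 2 * π * R / Q ^ 7 ≤ 1 / 10 := by
    calc 2 * π * R / Q ^ 7 ≤ 2 * 3.15 * Q / Q ^ 7 := by gcongr
      _ = 6.3 / Q ^ 6 := by field_simp; norm_num
      _ ≤ 6.3 / 2 ^ 6 := by gcongr
      _ ≤ 1 / 10 := by norm_num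
  generalize 2 * π * R / Q ^ 7 = X at *
  have he : 1 / Q ^ 32 ≤ 1 / (1000 * Q) := by
    apply one_div_le_one_div_of_le (by positivity)
    calc 1000 * Q ≤ 2 ^ 31 * Q := by gcongr; norm_num
      _ ≤ Q ^ 31 * Q := by gcongr
      _ = Q ^ 32 := by ring
  have hQe : 1 / (1000 * Q) * Q = 1 / 1000 := by field_simp
  have hQ1 : 1 / (1000 * Q) ≤ 1 / 1000 :=
    one_div_le_one_div_of_le (by norm_num) (by linarith)
  have heaQ : ea ≤ 1 / 1000 := by linarith
  have hebQ : G * eb ≤ 1 / 1000 := by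
    calc G * eb ≤ Q * (1 / (1000 * Q)) := by gcongr; linarith
      _ = 1 / 1000 := by linarith
  have hebs : eb ≤ 1 / 1000 := by linarith
  have hηb : |η| * (20 * Q) ≤ b := by
    calc |η| * (20 * Q) = |η| * (4 * (5 * Q)) := by ring
      _ ≤ |η| * (4 * t) := by gcongr
      _ ≤ b := hη
  -- The condition `b t ^ 4 < 1` enters here: it makes the cubic errors of the sines negligible even
  -- after multiplication by a digit as large as `Q`.
  have hQ3b : Q ^ 3 * b ≤ 1 / 1000 := by
    have h5 : (5 * Q) ^ 4 ≤ t ^ 4 := by gcongr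
    have h6 : b * (5 * Q) ^ 4 ≤ 1 := le_trans (by gcongr) hsmall.le
    have h7 : 0 ≤ Q ^ 3 * b := by positivity
    have h8 : b * (5 * Q) ^ 4 = 625 * (Q * (Q ^ 3 * b)) := by ring
    have h9 : 2 * (Q ^ 3 * b) ≤ Q * (Q ^ 3 * b) := by gcongr
    linarith
  have hQ8 : (1 : ℝ) ≤ Q ^ 3 := one_le_pow₀ (by linarith)
  have hb3 : b ≤ 1 / 1000 := le_trans (le_mul_of_one_le_left hpos.le hQ8) hQ3b
  have hη0 := abs_nonneg η
  have hηs : |η| ≤ b / 40 := by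
    have : |η| * (20 * 2) ≤ |η| * (20 * Q) := by gcongr
    linarith
  have hβη : |β * η| ≤ |η| := by
    rw [abs_mul, abs_of_nonneg hβ0]
    exact mul_le_of_le_one_left hη0 hβ1
  set xb := X * (1 + eb) + β * η with hxb
  set xa := X * (G + ea) + α * η with hxa
  have hxb1 : |xb| ≤ 1 := by
    have h := abs_add_le (X * (1 + eb)) (β * η)
    rw [abs_of_nonneg (by positivity : 0 ≤ X * (1 + eb))] at h
    have h' : X * (1 + eb) ≤ 1 / 10 * 2 := by gcongr; linarith
    linarith
  have hxb0 : 0 < xb := by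
    by_contra hn
    push Not at hn
    have := sin_nonpos_of_nonpos_of_neg_pi_le hn (by linarith [(abs_le.1 hxb1).1, pi_gt_three])
    linarith
  have hsb := abs_sin_sub_le xb
  rw [← heb] at hsb
  rw [abs_of_pos hxb0] at hsb hxb1
  have hsb' := (abs_le.1 hsb).1
  have hcub : xb ^ 3 ≤ xb := by
    calc xb ^ 3 = xb * (xb * xb) := by ring
      _ ≤ xb * (1 * 1) := by gcongr
      _ = xb := by ring
  have hxbb : xb ≤ 6 / 5 * b := by linarith
  have hXb : X ≤ 5 / 4 * b := by
    have h := (abs_le.1 (hβη.trans hηs)).1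
    have h' : X ≤ X * (1 + eb) := le_mul_of_one_le_right hX0 (by linarith)
    linarith
  -- The main terms `X * G` cancel. What remains are the tails and the offset `η`, whose factor of
  -- size `Q` is absorbed by `|η| * (20 * Q) ≤ b`.
  have hd : |xa - G * xb| ≤ 11 / 100 * b := by
    have e1 : xa - G * xb = X * (ea - G * eb) + (α - G * β) * η := by rw [hxa, hxb]; ring
    have e2 : |ea - G * eb| ≤ 1 / 1000 := by
      rw [abs_le]
      have : 0 ≤ G * eb := by positivity
      constructor <;> linarith
    have e3 : |α - G * β| ≤ 1 + Q := by
      rw [abs_le]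
      have : G * β ≤ Q * 1 := by gcongr
      have : 0 ≤ G * β := by positivity
      constructor <;> linarith
    have e4 : (1 + Q) * |η| ≤ b / 10 := by
      have : (1 + Q) * |η| ≤ 2 * Q * |η| := by gcongr; linarith
      linarith
    calc |xa - G * xb| ≤ |X * (ea - G * eb)| + |(α - G * β) * η| := by rw [e1]; exact abs_add_le _ _
      _ = X * |ea - G * eb| + |α - G * β| * |η| := by rw [abs_mul, abs_mul, abs_of_nonneg hX0]
      _ ≤ (5 / 4 * b) * (1 / 1000) + (1 + Q) * |η| := by gcongr
      _ ≤ 11 / 100 * b := by linarith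
  have hbQ : (Q * b) ^ 3 ≤ b / 1000 := by
    calc (Q * b) ^ 3 = (Q ^ 3 * b) * (b * b) := by ring
      _ ≤ 1 / 1000 * (1 * b) := by gcongr; linarith
      _ = b / 1000 := by ring
  have hca : |a - xa| ≤ b / 100 := by
    have h := abs_sin_sub_le xa
    rw [← hea] at h
    have hxa2 : |xa| ≤ 2 * (Q * b) := by
      have := abs_add_le (xa - G * xb) (G * xb)
      rw [sub_add_cancel, abs_of_nonneg (by positivity : 0 ≤ G * xb)] at this
      have h3 : G * xb ≤ Q * (6 / 5 * b) := by gcongr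
      have h5 : b ≤ Q * b := le_mul_of_one_le_left hpos.le (by linarith)
      linarith
    have h4 : |xa| ^ 3 ≤ (2 * (Q * b)) ^ 3 := by gcongr
    rw [mul_pow] at h4
    linarith
  have hcb : |G * (b - xb)| ≤ b / 100 := by
    rw [abs_mul, abs_of_nonneg hg0]
    have h4 : xb ^ 3 ≤ (6 / 5 * b) ^ 3 := by gcongr
    calc G * |b - xb| ≤ Q * ((6 / 5 * b) ^ 3 / 6) := by gcongr; linarith
      _ ≤ Q ^ 3 * ((6 / 5 * b) ^ 3 / 6) := by
        gcongr
        exact le_self_pow₀ (by linarith) (by norm_num)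
      _ = (6 / 5) ^ 3 / 6 * (Q * b) ^ 3 := by ring
      _ ≤ b / 100 := by linarith
  -- Linearization of both sines costs `b / 100` each, the angles differ by `11 b / 100`; the sum is
  -- below `b / 4`.
  have e5 : a - G * b = (a - xa) + (xa - G * xb) - G * (b - xb) := by ring
  rw [e5]
  have h6 := abs_sub ((a - xa) + (xa - G * xb)) (G * (b - xb))
  have h7 := abs_add_le (a - xa) (xa - G * xb)
  linarith

open Real in
/-- Times at which the rotation with frequency `β` is almost at rest read off a digit. -/
theorem exists_digit_of_small {t : ℝ} (ht : 1 < t) (hc : 0 < cos t)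
    (hcb : 0 < cos (digitReal (fun _ => 1) * t))
    (hsmall : sin (digitReal (fun _ => 1) * t) * t ^ 4 < 1)
    (hs : |8 * t * sin t| < sin (digitReal (fun _ => 1) * t)) :
    ∃ k : ℕ, ∀ g : ℕ → ℕ, (∀ i, g i ≤ i + 1) →
      |sin (digitReal g * t) - g (k + 1) * sin (digitReal (fun _ => 1) * t)| <
        sin (digitReal (fun _ => 1) * t) / 4 := by
  have h1g : ∀ i, (fun _ : ℕ => 1) i ≤ i + 1 := fun i => by simp
  have hβ0 := digitReal_nonneg h1g
  have hβ1 := digitReal_le_one h1g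
  obtain ⟨p, η, hp, hη⟩ := exists_int_of_cos_pos hc
  obtain ⟨p', ζ, hp', hζ⟩ := exists_int_of_cos_pos hcb
  have hpos : 0 < sin (digitReal (fun _ => 1) * t) := lt_of_le_of_lt (abs_nonneg _) hs
  rw [abs_of_pos hpos] at hζ
  set β := digitReal (fun _ => 1)
  set b := sin (β * t)
  have hpi := pi_gt_three
  have ht0 : 0 < t := by linarith
  have hηb : |η| * (4 * t) ≤ b := by
    rw [abs_mul, abs_of_pos (by positivity : 0 < 8 * t)] at hs
    nlinarith
  have hb1 : b < 1 := by
    have : (1 : ℝ) ≤ t ^ 4 := one_le_pow₀ ht.le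
    nlinarith
  have hη4 : |η| ≤ b / 4 := by nlinarith [abs_nonneg η]
  have hη1 := abs_le.1 hη4
  have hp0 : 0 < p := by
    by_contra hn
    have : (p : ℝ) ≤ 0 := by exact_mod_cast not_lt.1 hn
    nlinarith
  obtain ⟨q, rfl⟩ : ∃ q : ℕ, p = q := ⟨p.toNat, by omega⟩
  have hq : 1 ≤ q := by omega
  have hq1 : (1 : ℝ) ≤ q := by exact_mod_cast hq
  push_cast at hp
  have ht5 : 5 * (q : ℝ) ≤ t := by nlinarith
  -- Comparing `β t` with its nearest full turn gives an error of at most `3 b / (2 π) ≤ b`, and `b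
  -- < 1 / t ^ 4` with `t ≥ 5 q`.
  have happ : |β * q - p'| < 1 / (100 * (q : ℝ) ^ 4) := by
    have h1 : (β * q - p') * (2 * π) = ζ - β * η := by
      have : β * (q * (2 * π) + η) = p' * (2 * π) + ζ := by rw [← hp, ← hp']
      linarith
    have h2 : |ζ - β * η| ≤ 3 * b := by
      have h := abs_sub ζ (β * η)
      rw [abs_mul β, abs_of_nonneg hβ0] at h
      nlinarith [abs_nonneg η]
    rw [← h1, abs_mul, abs_of_pos (by positivity : 0 < 2 * π)] at h2
    have h3 : |β * q - p'| ≤ b := by nlinarith [abs_nonneg (β * q - p')]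
    refine h3.trans_lt ?_
    rw [lt_div_iff₀ (by positivity)]
    have : (5 * (q : ℝ)) ^ 4 ≤ t ^ 4 := by gcongr
    have : b * (5 * (q : ℝ)) ^ 4 ≤ b * t ^ 4 := by gcongr
    have : b * (5 * (q : ℝ)) ^ 4 = 625 * (b * (q : ℝ) ^ 4) := by ring
    have : 0 ≤ b * (q : ℝ) ^ 4 := by positivity
    linarith
  obtain ⟨k, r, hr, hrk, rfl⟩ := exists_scale_of_approx hq happ
  push_cast at hp ht5
  exact ⟨k, fun g hg => abs_sin_sub_digit_mul_sin_lt hg hr hrk (by rw [hp]; ring) ht5 hpos hηb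
    hsmall⟩

open Real in
/-- At the times `2 π (scale k)` the digits are read off. -/
theorem digit_of_scale {k : ℕ} (hk : 1 ≤ k) {t : ℝ} (ht : t = 2 * π * scale k) :
    1 < t ∧ cos t = 1 ∧ sin t = 0 ∧ 0 < cos (digitReal (fun _ => 1) * t) ∧
      0 < sin (digitReal (fun _ => 1) * t) ∧ sin (digitReal (fun _ => 1) * t) * t ^ 4 < 1 ∧
      ∀ g : ℕ → ℕ, (∀ i, g i ≤ i + 1) →
        |sin (digitReal g * t) - g (k + 1) * sin (digitReal (fun _ => 1) * t)| <
          sin (digitReal (fun _ => 1) * t) / 4 := by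
  have h1g : ∀ i, (fun _ : ℕ => 1) i ≤ i + 1 := fun i => by simp
  have hpi := pi_gt_three
  have hpi4 : π < 3.15 := pi_lt_d2
  -- The estimate of `sin (β t) * t ^ 4` below is useless for `scale 0 = 2`. Hence `k ≥ 1`, and only
  -- digits with index at least 2 are certain to be read.
  have hQ : (256 : ℝ) ≤ scale k := by
    obtain ⟨j, rfl⟩ : ∃ j, k = j + 1 := ⟨k - 1, by omega⟩
    rw [scale_succ]
    calc (256 : ℝ) = 2 ^ 8 := by norm_num
      _ ≤ (scale j : ℝ) ^ 8 := by gcongr; exact two_le_scale j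
  obtain ⟨e, he0, he1, he⟩ := exists_scale_mul_digitReal h1g k
  have he2 : e ≤ 1 := he1.trans ((div_le_one (by positivity)).2 (one_le_pow₀ (by linarith)))
  have hx : digitReal (fun _ => 1) * t =
      2 * π * (1 + e) / (scale k : ℝ) ^ 7 + digitNum (fun _ => 1) k * (2 * π) := by
    calc _ = 2 * π * (scale k * digitReal (fun _ => 1)) := by rw [ht]; ring
      _ = _ := by rw [he]; push_cast; ring
  have hsin : sin (digitReal (fun _ => 1) * t) = sin (2 * π * (1 + e) / (scale k : ℝ) ^ 7) := by
    rw [hx, sin_add_nat_mul_two_pi]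
  have hcos : cos (digitReal (fun _ => 1) * t) = cos (2 * π * (1 + e) / (scale k : ℝ) ^ 7) := by
    rw [hx, cos_add_nat_mul_two_pi]
  have hxpos : 0 < 2 * π * (1 + e) / (scale k : ℝ) ^ 7 := by positivity
  have hxle : 2 * π * (1 + e) / (scale k : ℝ) ^ 7 ≤ 12.6 / (scale k : ℝ) ^ 7 := by
    gcongr
    nlinarith
  have hxle1 : 12.6 / (scale k : ℝ) ^ 7 ≤ 1 := by
    rw [div_le_one (by positivity)]
    calc (12.6 : ℝ) ≤ 256 ^ 7 := by norm_num
      _ ≤ (scale k : ℝ) ^ 7 := by gcongr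
  have hspos : 0 < sin (2 * π * (1 + e) / (scale k : ℝ) ^ 7) :=
    sin_pos_of_pos_of_lt_pi hxpos (by linarith)
  have hsm : sin (2 * π * (1 + e) / (scale k : ℝ) ^ 7) * t ^ 4 < 1 := by
    have h1 : sin (2 * π * (1 + e) / (scale k : ℝ) ^ 7) ≤ 12.6 / (scale k : ℝ) ^ 7 :=
      (sin_le hxpos.le).trans hxle
    have h2 : t ^ 4 ≤ (6.3 * (scale k : ℝ)) ^ 4 := by
      rw [ht]
      gcongr
      linarith
    calc _ ≤ 12.6 / (scale k : ℝ) ^ 7 * (6.3 * (scale k : ℝ)) ^ 4 := by gcongr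
      _ = 12.6 * 6.3 ^ 4 / (scale k : ℝ) ^ 3 := by field_simp
      _ ≤ 12.6 * 6.3 ^ 4 / 256 ^ 3 := by gcongr
      _ < 1 := by norm_num
  have ht1 : 1 < t := by rw [ht]; nlinarith
  refine ⟨ht1, ?_, ?_, ?_, by rwa [hsin], by rwa [hsin], fun g hg => ?_⟩
  · rw [ht, mul_comm, cos_nat_mul_two_pi]
  · rw [ht, mul_comm, ← zero_add ((scale k : ℝ) * (2 * π)), sin_add_nat_mul_two_pi, sin_zero]
  · rw [hcos]
    exact cos_pos_of_mem_Ioo ⟨by linarith, by linarith⟩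
  · refine abs_sin_sub_digit_mul_sin_lt hg (r := 1) (k := k) (η := 0) le_rfl ?_ ?_ ?_ ?_ ?_ ?_
    · have := add_two_le_scale k
      omega
    · rw [ht]; simp
    · rw [ht]; push_cast; nlinarith
    · rwa [hsin]
    · rw [abs_zero, zero_mul, hsin]; exact hspos.le
    · rwa [hsin]


/-! ## The vector field -/

section Field

variable {n : ℕ}

/-- The coordinates used by the vector field. -/
def coord (h : 9 ≤ n) (j : Fin 9) : Fin n := Fin.castLE h j

/-- Exponents and coefficients of the vector field: a clock, three planar rotations with the
frequencies `1`, `α` and `β`, a constant coordinate, and one equation `z' = z ^ 56`. -/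
noncomputable def scanTerm (h : 9 ≤ n) (α β : ℝ) : ℕ → (Fin n →₀ ℕ) × ℝ
  | 0 => (0, 1)
  | 1 => (Finsupp.single (coord h 2) 1, 1)
  | 2 => (Finsupp.single (coord h 1) 1, -1)
  | 3 => (Finsupp.single (coord h 4) 1, α)
  | 4 => (Finsupp.single (coord h 3) 1, -α)
  | 5 => (Finsupp.single (coord h 6) 1, β)
  | 6 => (Finsupp.single (coord h 5) 1, -β)
  | 8 => (Finsupp.single (coord h 8) 56, 1)
  | _ => (0, 0)

/-- The polynomial vector field with the components `scanTerm`. -/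
noncomputable def scanField (h : 9 ≤ n) (α β : ℝ) (i : Fin n) : MvPolynomial (Fin n) ℝ :=
  MvPolynomial.monomial (scanTerm h α β i).1 (scanTerm h α β i).2

theorem fieldDegree_scanField (h : 9 ≤ n) (α β : ℝ) : fieldDegree (scanField h α β) = 56 := by
  apply le_antisymm
  · refine Finset.sup_le fun i _ => ?_
    refine (MvPolynomial.totalDegree_monomial_le _ _).trans ?_
    rcases i with ⟨i, hi⟩
    change ((scanTerm h α β i).1).degree ≤ 56
    unfold scanTerm
    split <;> simp
  · have hle := Finset.le_sup (f := fun i => (scanField h α β i).totalDegree)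
      (Finset.mem_univ (coord h 8))
    refine le_trans (le_of_eq ?_) hle
    change 56 = (MvPolynomial.monomial (Finsupp.single (coord h 8) 56) (1 : ℝ)).totalDegree
    rw [MvPolynomial.totalDegree_monomial _ one_ne_zero, Finsupp.sum_single_index rfl]

theorem isConstructible_scanField (h : 9 ≤ n) {α β : ℝ} (hα : IsComputableReal α)
    (hβ : IsComputableReal β) : IsConstructible (scanField h α β) := by
  have h0 : IsComputableReal 0 := by simpa using isComputableReal_natCast 0
  have h1 : IsComputableReal 1 := by simpa using isComputableReal_natCast 1
  intro i m
  rw [scanField, MvPolynomial.coeff_monomial]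
  split
  · unfold scanTerm
    split
    exacts [h1, h1, h1.neg, hα, hα.neg, hβ, hβ.neg, h1, h0]
  · exact h0

theorem polyField_scanField (h : 9 ≤ n) (α β : ℝ) (x : Fin n → ℝ) (i : Fin n) :
    polyField (scanField h α β) x i =
      (scanTerm h α β i).2 * (scanTerm h α β i).1.prod fun j e => x j ^ e := by
  simp [polyField, scanField, MvPolynomial.eval_monomial]

/-- The initial point with data `m`. -/
def startCode (n : ℕ) (m : ℕ) : PointCode n := fun i =>
  (if (i : ℕ) = 2 ∨ (i : ℕ) = 4 ∨ (i : ℕ) = 6 then 1 else if (i : ℕ) = 7 then m else 0, 0, 0)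

/-- The integral curve through the initial point. -/
noncomputable def scanCurve (n : ℕ) (α β : ℝ) (m : ℕ) (t : ℝ) (i : Fin n) : ℝ :=
  match (i : ℕ) with
  | 0 => t
  | 1 => Real.sin t
  | 2 => Real.cos t
  | 3 => Real.sin (α * t)
  | 4 => Real.cos (α * t)
  | 5 => Real.sin (β * t)
  | 6 => Real.cos (β * t)
  | 7 => m
  | _ => 0

theorem scanCurve_zero (n : ℕ) (α β : ℝ) (m : ℕ) :
    scanCurve n α β m 0 = pointVal (startCode n m) := by
  funext i
  simp only [scanCurve, pointVal, startCode, ratVal]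
  split <;> simp_all

theorem hasDerivAt_scanCurve (h : 9 ≤ n) (α β : ℝ) (m : ℕ) (t : ℝ) :
    HasDerivAt (scanCurve n α β m) (polyField (scanField h α β) (scanCurve n α β m t)) t := by
  have hs : ∀ ω : ℝ, HasDerivAt (fun t => Real.sin (ω * t)) (ω * Real.cos (ω * t)) t := fun ω => by
    simpa [mul_comm] using ((hasDerivAt_id t).const_mul ω).sin
  have hc : ∀ ω : ℝ, HasDerivAt (fun t => Real.cos (ω * t)) (-ω * Real.sin (ω * t)) t :=
    fun ω => by simpa [mul_comm] using ((hasDerivAt_id t).const_mul ω).cos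
  rw [hasDerivAt_pi]
  rintro ⟨i, hi⟩
  rw [polyField_scanField]
  simp only [scanCurve, scanTerm]
  match i with
  | 0 => simpa using hasDerivAt_id' t
  | 1 => simpa [coord] using Real.hasDerivAt_sin t
  | 2 => simpa [coord] using Real.hasDerivAt_cos t
  | 3 => simpa [coord] using hs α
  | 4 => simpa [coord] using hc α
  | 5 => simpa [coord] using hs β
  | 6 => simpa [coord] using hc β
  | 7 => simpa using hasDerivAt_const t (m : ℝ)
  -- The rest point 0 of `z' = z ^ 56`: no blow-up, the curve exists for all times.
  | 8 => simpa [coord] using hasDerivAt_const t (0 : ℝ)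
  | i + 9 => simpa using hasDerivAt_const t (0 : ℝ)

/-! ### Uniqueness of the integral curves -/

theorem eq_of_hasDerivAt_zero {a b : ℝ} (h0 : (0 : ℝ) ∈ Set.Ioo a b) {f : ℝ → ℝ}
    (hf : ∀ t ∈ Set.Ioo a b, HasDerivAt f 0 t) {t : ℝ} (ht : t ∈ Set.Ioo a b) : f t = f 0 := by
  have := (convex_Ioo a b).norm_image_sub_le_of_norm_hasDerivWithin_le (C := 0)
    (fun x hx => (hf x hx).hasDerivWithinAt) (fun x _ => by simp) h0 ht
  simpa [sub_eq_zero] using this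

/-- Uniqueness for planar rotations. -/
theorem eq_sin_cos_of_hasDerivAt {a b : ℝ} (h0 : (0 : ℝ) ∈ Set.Ioo a b) {ω : ℝ} {s c : ℝ → ℝ}
    (hs : ∀ t ∈ Set.Ioo a b, HasDerivAt s (ω * c t) t)
    (hc : ∀ t ∈ Set.Ioo a b, HasDerivAt c (-ω * s t) t) (hs0 : s 0 = 0) (hc0 : c 0 = 1)
    {t : ℝ} (ht : t ∈ Set.Ioo a b) : s t = Real.sin (ω * t) ∧ c t = Real.cos (ω * t) := by
  have dS : ∀ t, HasDerivAt (fun t => Real.sin (ω * t)) (ω * Real.cos (ω * t)) t := fun t => by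
    simpa [mul_comm] using ((hasDerivAt_id t).const_mul ω).sin
  have dC : ∀ t, HasDerivAt (fun t => Real.cos (ω * t)) (-ω * Real.sin (ω * t)) t :=
    fun t => by simpa [mul_comm] using ((hasDerivAt_id t).const_mul ω).cos
  -- In the frame rotating with frequency `ω` the solution is at rest; `hA` and `hB` are its two
  -- constant coordinates.
  have hA := eq_of_hasDerivAt_zero h0
    (f := fun t => s t * Real.sin (ω * t) + c t * Real.cos (ω * t))
    (fun t ht => (((hs t ht).fun_mul (dS t)).fun_add ((hc t ht).fun_mul (dC t))).congr_deriv
      (by ring)) ht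
  have hB := eq_of_hasDerivAt_zero h0
    (f := fun t => s t * Real.cos (ω * t) - c t * Real.sin (ω * t))
    (fun t ht => (((hs t ht).fun_mul (dC t)).fun_sub ((hc t ht).fun_mul (dS t))).congr_deriv
      (by ring)) ht
  simp only [hs0, hc0, mul_zero, Real.sin_zero, Real.cos_zero, one_mul, zero_mul, sub_zero,
    zero_add] at hA hB
  have h1 := Real.sin_sq_add_cos_sq (ω * t)
  constructor
  · linear_combination Real.sin (ω * t) * hA + Real.cos (ω * t) * hB - s t * h1
  · linear_combination Real.cos (ω * t) * hA - Real.sin (ω * t) * hB - c t * h1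

/-- The first eight coordinates of every integral curve through the initial point. -/
theorem eq_scanCurve (h : 9 ≤ n) {α β : ℝ} {m : ℕ} {a b : ℝ} (h0 : (0 : ℝ) ∈ Set.Ioo a b)
    {γ : ℝ → Fin n → ℝ} (hγ0 : γ 0 = pointVal (startCode n m))
    (hγ : IsIntegralCurveOn γ (fun _ => polyField (scanField h α β)) (Set.Ioo a b))
    {t : ℝ} (ht : t ∈ Set.Ioo a b) {j : Fin 9} (hj : j < 8) :
    γ t (coord h j) = scanCurve n α β m t (coord h j) := by
  have hd : ∀ i, ∀ t ∈ Set.Ioo a b, HasDerivAt (fun t => γ t i)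
      ((scanTerm h α β i).2 * (scanTerm h α β i).1.prod fun j e => γ t j ^ e) t := fun i t ht => by
    rw [← polyField_scanField]
    exact hasDerivAt_pi.1 ((hγ t ht).hasDerivAt (Ioo_mem_nhds ht.1 ht.2)) i
  have hz : ∀ i, γ 0 i = pointVal (startCode n m) i := fun i => by rw [hγ0]
  have r1 := eq_sin_cos_of_hasDerivAt (ω := 1) (s := fun t => γ t (coord h 1))
    (c := fun t => γ t (coord h 2)) h0
    (fun t ht => by simpa [scanTerm, coord] using hd (coord h 1) t ht)
    (fun t ht => by simpa [scanTerm, coord] using hd (coord h 2) t ht)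
    (by simp [hz, coord, pointVal, startCode, ratVal])
    (by simp [hz, coord, pointVal, startCode, ratVal]) ht
  have r2 := eq_sin_cos_of_hasDerivAt (ω := α) (s := fun t => γ t (coord h 3))
    (c := fun t => γ t (coord h 4)) h0
    (fun t ht => by simpa [scanTerm, coord] using hd (coord h 3) t ht)
    (fun t ht => by simpa [scanTerm, coord] using hd (coord h 4) t ht)
    (by simp [hz, coord, pointVal, startCode, ratVal])
    (by simp [hz, coord, pointVal, startCode, ratVal]) ht
  have r3 := eq_sin_cos_of_hasDerivAt (ω := β) (s := fun t => γ t (coord h 5))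
    (c := fun t => γ t (coord h 6)) h0
    (fun t ht => by simpa [scanTerm, coord] using hd (coord h 5) t ht)
    (fun t ht => by simpa [scanTerm, coord] using hd (coord h 6) t ht)
    (by simp [hz, coord, pointVal, startCode, ratVal])
    (by simp [hz, coord, pointVal, startCode, ratVal]) ht
  rw [one_mul] at r1
  have r0 := eq_of_hasDerivAt_zero h0 (f := fun t => γ t (coord h 0) - t)
    (fun t ht => by simpa [scanTerm, coord] using (hd (coord h 0) t ht).fun_sub (hasDerivAt_id' t))
    ht
  have r7 := eq_of_hasDerivAt_zero h0 (f := fun t => γ t (coord h 7))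
    (fun t ht => by simpa [scanTerm, coord] using hd (coord h 7) t ht) ht
  match j, hj with
  | 0, _ => simpa [hz, coord, pointVal, startCode, ratVal, sub_eq_zero, scanCurve] using r0
  | 1, _ => exact r1.1
  | 2, _ => exact r1.2
  | 3, _ => exact r2.1
  | 4, _ => exact r2.2
  | 5, _ => exact r3.1
  | 6, _ => exact r3.2
  | 7, _ => simpa [hz, coord, pointVal, startCode, ratVal, scanCurve] using r7

end Field

/-! ## Simulation of Turing machines on finite descriptions -/

/-- The symbols on a tape presented by two finite words, as natural numbers. -/
def natTape (L R : List ℕ) (i : ℤ) : ℕ :=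
  if 0 ≤ i then R.getD i.toNat 0 else L.getD (-i - 1).toNat 0

/-- The table entry that applies to a configuration. -/
def entry (C : TuringMachine.Code) (x : ℕ × List ℕ × List ℕ) : ℕ × ℕ × ℕ :=
  (C.2.2.2.2.getD x.1 []).getD (x.2.2.getD 0 0) (0, 0, 0)

/-- Writing a symbol and moving, for tapes presented by two finite words. -/
def moveTape (e : ℕ × ℕ × ℕ) (x : List ℕ × List ℕ) : List ℕ × List ℕ :=
  if e.2.2 = 0 then (x.1.tail, x.1.getD 0 0 :: e.2.1 :: x.2.tail)
  else if e.2.2 = 1 then (x.1, e.2.1 :: x.2.tail)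
  else (e.2.1 :: x.1, x.2.tail)

/-- One step of a described machine. -/
def codeStep (C : TuringMachine.Code) (x : ℕ × List ℕ × List ℕ) : ℕ × List ℕ × List ℕ :=
  if x.1 = C.2.2.2.1 then x else ((entry C x).1, moveTape (entry C x) x.2)

/-- The configuration of a described machine after `j` steps. -/
def codeRun (d : TuringMachine.Code × List ℕ × List ℕ) (j : ℕ) : ℕ × List ℕ × List ℕ :=
  (codeStep d.1)^[j] (d.1.2.2.1, d.2)

/-- The symbols in a window of length `l` around the head. -/
def window (x : List ℕ × List ℕ) (l : ℕ) : List ℕ :=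
  (List.range l).map fun i =>
    if l / 2 ≤ i then x.2.getD (i - l / 2) 0 else x.1.getD (l / 2 - i - 1) 0

/-- After `j` steps the described machine has halted with output `w`. -/
def HaltedWith (d : TuringMachine.Code × List ℕ × List ℕ) (w : List ℕ) (j : ℕ) : Prop :=
  (codeRun d j).1 = d.1.2.2.2.1 ∧ window (codeRun d j).2 w.length = w

instance (d : TuringMachine.Code × List ℕ × List ℕ) (w : List ℕ) (j : ℕ) :
    Decidable (HaltedWith d w j) :=
  inferInstanceAs (Decidable (_ ∧ _))

/-! ### Enumeration of the halting computations -/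

/-- An injective quadratic pairing function with positive values. -/
def quadPair (a b : ℕ) : ℕ := (a + b) ^ 2 + a + 1

/-- With `s = a + b`, the value lies strictly above `s ^ 2` and at most at `(s + 1) ^ 2`, so it
determines `s` and then `a`. -/
theorem quadPair_injective {a b a' b' : ℕ} (h : quadPair a b = quadPair a' b') :
    a = a' ∧ b = b' := by
  unfold quadPair at h
  have hs : a + b = a' + b' := by
    rcases lt_trichotomy (a + b) (a' + b') with hlt | heq | hlt
    · nlinarith
    · exact heq
    · nlinarith
  rw [hs] at h
  omega

/-- The code of a pair of a halting computation and a part of its output, if this is confirmed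
after `j` steps, and `0` otherwise. -/
def haltingEntry (i j : ℕ) (p : (TuringMachine.Code × List ℕ × List ℕ) × List ℕ) : ℕ :=
  if HaltedWith p.1 p.2 j ∧ quadPair (Encodable.encode p.1) (Encodable.encode p.2) ≤ i
  then quadPair (Encodable.encode p.1) (Encodable.encode p.2) else 0

/-- An enumeration of the codes of all pairs of a halting computation and a part of its output. -/
def haltingList (i : ℕ) : ℕ :=
  ((Encodable.decode i.unpair.1 : Option ((TuringMachine.Code × List ℕ × List ℕ) × List ℕ)).map
    (haltingEntry i i.unpair.2)).getD 0

theorem haltingEntry_le (i j : ℕ) (p : (TuringMachine.Code × List ℕ × List ℕ) × List ℕ) :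
    haltingEntry i j p ≤ i := by
  unfold haltingEntry
  split
  · rename_i h
    exact h.2
  · exact Nat.zero_le _

/-- The guard in `haltingEntry` is there for this bound: it keeps the digits small against the
denominators. -/
theorem haltingList_le (i : ℕ) : haltingList i ≤ i := by
  unfold haltingList
  cases (Encodable.decode i.unpair.1 :
    Option ((TuringMachine.Code × List ℕ × List ℕ) × List ℕ)) with
  | none => exact Nat.zero_le _
  | some p => exact haltingEntry_le i _ p

/-! ### Correctness -/

theorem wordCode_eq_map {s : ℕ} (w : List (Fin s)) : wordCode w = w.map Fin.val := by
  induction w with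
  | nil => rfl
  | cons a w ih => exact congrArg (List.cons (a : ℕ)) ih

theorem natTape_wordCode (T : TuringMachine) (L R : List (Fin T.symbols)) (i : ℤ) :
    natTape (wordCode L) (wordCode R) i = T.tapeOf L R i := by
  have h : ∀ (l : List (Fin T.symbols)) (m : ℕ),
      (wordCode l).getD m 0 = (l.getD m T.blank : Fin T.symbols) := fun l m => by
    simp only [List.getD_eq_getElem?_getD, wordCode_eq_map, List.getElem?_map]
    cases l[m]? <;> simp [TuringMachine.blank]
  unfold natTape TuringMachine.tapeOf
  split <;> exact h _ _

theorem natTape_natCast (L R : List ℕ) (m : ℕ) : natTape L R m = R.getD m 0 := by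
  simp [natTape]

theorem natTape_neg (L R : List ℕ) (m : ℕ) : natTape L R (-m - 1) = L.getD m 0 := by
  rw [natTape, if_neg (by omega)]
  congr 1
  omega

theorem natTape_moveTape (L R : List ℕ) (q a : ℕ) (ε : SignType) (i : ℤ) :
    natTape (moveTape (q, a, TuringMachine.shiftCode ε) (L, R)).1
      (moveTape (q, a, TuringMachine.shiftCode ε) (L, R)).2 i =
      Function.update (natTape L R) 0 a (i + (ε : ℤ)) := by
  have hR : ∀ m : ℕ, R.tail.getD m 0 = R.getD (m + 1) 0 := fun m => by cases R <;> simp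
  have hL : ∀ m : ℕ, L.tail.getD m 0 = L.getD (m + 1) 0 := fun m => by cases L <;> simp
  have u0 : ∀ j : ℤ, j = 0 → Function.update (natTape L R) 0 a j = a := by
    rintro j rfl
    simp
  have u1 : ∀ (m : ℕ) (j : ℤ), j = m + 1 →
      Function.update (natTape L R) 0 a j = R.getD (m + 1) 0 := fun m j hj => by
    rw [Function.update_of_ne (by omega), show j = ((m + 1 : ℕ) : ℤ) by omega, natTape_natCast]
  have u2 : ∀ (m : ℕ) (j : ℤ), j = -m - 1 →
      Function.update (natTape L R) 0 a j = L.getD m 0 := fun m j hj => by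
    rw [Function.update_of_ne (by omega), hj, natTape_neg]
  obtain rfl | rfl | rfl : ε = -1 ∨ ε = 0 ∨ ε = 1 := by cases ε <;> decide
  all_goals
    obtain ⟨m, rfl | rfl⟩ : ∃ m : ℕ, i = m ∨ i = -m - 1 := by
      rcases lt_or_ge i 0 with h | h
      · exact ⟨(-i - 1).toNat, Or.inr (by omega)⟩
      · exact ⟨i.toNat, Or.inl (by omega)⟩
    all_goals
      simp only [natTape_natCast, natTape_neg]
  · change (L.getD 0 0 :: a :: R.tail).getD m 0 = Function.update (natTape L R) 0 a ((m : ℤ) + -1)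
    rcases m with _ | _ | m
    · rw [u2 0 _ (by simp)]; rfl
    · rw [u0 _ (by simp)]; rfl
    · rw [u1 m _ (by push_cast; ring), ← hR]; rfl
  · change L.tail.getD m 0 = Function.update (natTape L R) 0 a (-(m : ℤ) - 1 + -1)
    rw [u2 (m + 1) _ (by push_cast; ring), hL]
  · change (a :: R.tail).getD m 0 = Function.update (natTape L R) 0 a ((m : ℤ) + 0)
    rcases m with _ | m
    · rw [u0 _ (by simp)]; rfl
    · rw [u1 m _ (by push_cast; ring), ← hR]; rfl
  · change L.getD m 0 = Function.update (natTape L R) 0 a (-(m : ℤ) - 1 + 0)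
    rw [u2 m _ (by ring)]
  · change R.tail.getD m 0 = Function.update (natTape L R) 0 a ((m : ℤ) + 1)
    rw [u1 m _ rfl, hR]
  · change (a :: L).getD m 0 = Function.update (natTape L R) 0 a (-(m : ℤ) - 1 + 1)
    rcases m with _ | m
    · rw [u0 _ (by simp)]; rfl
    · rw [u2 m _ (by push_cast; ring)]; rfl

/-- A described configuration presents a configuration of the machine. -/
def Presents {T : TuringMachine} (x : ℕ × List ℕ × List ℕ) (c : Fin T.states × T.Tape) : Prop :=
  x.1 = c.1 ∧ ∀ i, natTape x.2.1 x.2.2 i = c.2 i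

/-- State and symbol belong to a true configuration, so the default values in the table lookup never
occur. -/
theorem Presents.codeStep {T : TuringMachine} {x : ℕ × List ℕ × List ℕ}
    {c : Fin T.states × T.Tape} (h : Presents x c) : Presents (codeStep T.code x) (T.step c) := by
  obtain ⟨h1, h2⟩ := h
  have he : entry T.code x = (((T.δ c.1 (c.2 0)).1 : ℕ), ((T.δ c.1 (c.2 0)).2.1 : ℕ),
      TuringMachine.shiftCode (T.δ c.1 (c.2 0)).2.2) := by
    have h0 : x.2.2.getD 0 0 = c.2 0 := by simpa [natTape] using h2 0
    unfold entry
    rw [h0, h1]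
    simp [TuringMachine.code, List.getD_eq_getElem?_getD]
  unfold TuringODE.codeStep TuringMachine.step
  rw [he]
  have hq : x.1 = T.code.2.2.2.1 ↔ c.1 = T.qhalt := by
    rw [h1]
    exact Fin.val_inj
  by_cases hc : c.1 = T.qhalt
  · rw [if_pos hc, if_pos (hq.2 hc)]
    exact ⟨h1, h2⟩
  · rw [if_neg hc, if_neg (mt hq.1 hc)]
    refine ⟨rfl, fun i => ?_⟩
    rw [show x.2 = (x.2.1, x.2.2) from rfl, natTape_moveTape]
    simp only [Function.update_apply, h2]
    split <;> rfl

theorem presents_codeRun (T : TuringMachine) (L R : List (Fin T.symbols)) (j : ℕ) :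
    Presents (codeRun (T.code, wordCode L, wordCode R) j) (T.step^[j] (T.q₀, T.tapeOf L R)) := by
  induction j with
  | zero => exact ⟨rfl, natTape_wordCode T L R⟩
  | succ j ih =>
    rw [codeRun, Function.iterate_succ_apply', Function.iterate_succ_apply']
    exact ih.codeStep

theorem haltedWith_iff (T : TuringMachine) (L R : List (Fin T.symbols)) (k : ℕ)
    (w : Fin (2 * k + 1) → Fin T.symbols) (j : ℕ) :
    HaltedWith (T.code, wordCode L, wordCode R) (wordCode (List.ofFn w)) j ↔
      (T.step^[j] (T.q₀, T.tapeOf L R)).1 = T.qhalt ∧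
        ∀ i : Fin (2 * k + 1), (T.step^[j] (T.q₀, T.tapeOf L R)).2 ((i : ℤ) - (k : ℤ)) = w i := by
  obtain ⟨h1, h2⟩ := presents_codeRun T L R j
  unfold HaltedWith
  refine and_congr ?_ ?_
  · rw [h1]
    exact Fin.val_inj
  · have hlen : (wordCode (List.ofFn w)).length = 2 * k + 1 := by simp [wordCode_eq_map]
    rw [hlen, List.ext_get_iff]
    have hk : (2 * k + 1) / 2 = k := by omega
    have hw : ∀ i : ℕ, i < 2 * k + 1 →
        (if k ≤ i then (codeRun (T.code, wordCode L, wordCode R) j).2.2.getD (i - k) 0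
        else (codeRun (T.code, wordCode L, wordCode R) j).2.1.getD (k - i - 1) 0) =
          (T.step^[j] (T.q₀, T.tapeOf L R)).2 ((i : ℤ) - (k : ℤ)) := fun i hi => by
      rw [← h2, natTape]
      by_cases hki : k ≤ i
      · rw [if_pos hki, if_pos (by omega)]
        congr 1
        omega
      · rw [if_neg hki, if_neg (by omega)]
        congr 1
        omega
    have hg : ∀ (i : ℕ) (hi : i < 2 * k + 1) (hi' : i < (wordCode (List.ofFn w)).length),
        (wordCode (List.ofFn w)).get ⟨i, hi'⟩ = w ⟨i, hi⟩ := fun i hi hi' => by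
      simp only [wordCode_eq_map, List.get_eq_getElem, List.getElem_map, List.getElem_ofFn]
    constructor
    · rintro ⟨-, h⟩ i
      have := h i (by rw [window, List.length_map, List.length_range]; exact i.2)
        (by rw [hlen]; exact i.2)
      rw [hg i i.2] at this
      simp only [window, List.get_eq_getElem, List.getElem_map, List.getElem_range, hk] at this
      rw [hw i i.2] at this
      exact Fin.ext this
    · intro h
      refine ⟨by rw [window, List.length_map, List.length_range, hlen], fun i hi hi' => ?_⟩
      have hi2 := hi'
      rw [hlen] at hi2
      rw [hg i hi2]
      simp only [window, List.get_eq_getElem, List.getElem_map, List.getElem_range, hk]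
      rw [hw i hi2, h ⟨i, hi2⟩]

theorem HaltedWith.mono {d : TuringMachine.Code × List ℕ × List ℕ} {w : List ℕ} {j j' : ℕ}
    (h : HaltedWith d w j) (hj : j ≤ j') : HaltedWith d w j' := by
  have : codeRun d j' = codeRun d j := by
    obtain ⟨l, rfl⟩ := Nat.exists_eq_add_of_le hj
    induction l with
    | zero => rfl
    | succ l ih =>
      have := ih (by omega)
      rw [← add_assoc, codeRun, Function.iterate_succ_apply']
      change codeStep d.1 (codeRun d (j + l)) = _
      rw [this, codeStep, if_pos h.1]
  rwa [HaltedWith, this]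

theorem exists_haltingList_eq {d : TuringMachine.Code × List ℕ × List ℕ} {w : List ℕ} {j : ℕ}
    (h : HaltedWith d w j) :
    ∃ i, 2 ≤ i ∧ haltingList i = quadPair (Encodable.encode d) (Encodable.encode w) := by
  obtain ⟨N, hN⟩ : ∃ N, N = quadPair (Encodable.encode d) (Encodable.encode w) := ⟨_, rfl⟩
  -- Once halted, a machine stays halted, so the confirming time may be raised to `N + 2`; the index
  -- of the pair is then at least `N`, as the guard demands, and at least 2.
  have hle := Nat.right_le_pair (Encodable.encode (d, w)) (max j (N + 2))
  have h1 := h.mono (le_max_left j (N + 2))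
  have h2 := (le_max_right j (N + 2)).trans hle
  refine ⟨Nat.pair (Encodable.encode (d, w)) (max j (N + 2)), le_trans (Nat.le_add_left 2 N) h2, ?_⟩
  rw [haltingList, Nat.unpair_pair, Encodable.encodek, Option.map_some, Option.getD_some,
    haltingEntry, if_pos ⟨h1, hN ▸ (Nat.le_add_right N 2).trans h2⟩]

theorem exists_haltedWith {d : TuringMachine.Code × List ℕ × List ℕ} {w : List ℕ} {i : ℕ}
    (h : haltingList i = quadPair (Encodable.encode d) (Encodable.encode w)) :
    ∃ j, HaltedWith d w j := by
  have hpos : quadPair (Encodable.encode d) (Encodable.encode w) ≠ 0 := Nat.succ_ne_zero _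
  unfold haltingList at h
  generalize (Encodable.decode i.unpair.1 :
    Option ((TuringMachine.Code × List ℕ × List ℕ) × List ℕ)) = o at h
  rcases o with _ | p
  · exact absurd h.symm hpos
  · rw [Option.map_some, Option.getD_some, haltingEntry] at h
    split at h
    · rename_i hh
      obtain ⟨e1, e2⟩ := quadPair_injective h
      rw [← Encodable.encode_injective e1, ← Encodable.encode_injective e2]
      exact ⟨_, hh.1⟩
    · exact absurd h.symm hpos

/-! ### Computability -/

theorem primrec_entry : Primrec₂ entry := by
  have hrow : Primrec₂ fun (C : TuringMachine.Code) (x : ℕ × List ℕ × List ℕ) =>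
      C.2.2.2.2.getD x.1 [] :=
    (Primrec.list_getD []).comp
      (Primrec.snd.comp (Primrec.snd.comp (Primrec.snd.comp (Primrec.snd.comp Primrec.fst))))
      (Primrec.fst.comp Primrec.snd)
  exact (Primrec.list_getD (0, 0, 0)).comp hrow
    ((Primrec.list_getD 0).comp (Primrec.snd.comp (Primrec.snd.comp Primrec.snd))
      (Primrec.const 0))

theorem primrec_moveTape : Primrec₂ moveTape := by
  have hm : Primrec fun x : (ℕ × ℕ × ℕ) × List ℕ × List ℕ => x.1.2.2 :=
    Primrec.snd.comp (Primrec.snd.comp Primrec.fst)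
  have ha : Primrec fun x : (ℕ × ℕ × ℕ) × List ℕ × List ℕ => x.1.2.1 :=
    Primrec.fst.comp (Primrec.snd.comp Primrec.fst)
  have hL : Primrec fun x : (ℕ × ℕ × ℕ) × List ℕ × List ℕ => x.2.1 :=
    Primrec.fst.comp Primrec.snd
  have hR : Primrec fun x : (ℕ × ℕ × ℕ) × List ℕ × List ℕ => x.2.2.tail :=
    Primrec.list_tail.comp (Primrec.snd.comp Primrec.snd)
  refine Primrec.ite (Primrec.eq.comp hm (Primrec.const 0)) ?_
    (Primrec.ite (Primrec.eq.comp hm (Primrec.const 1)) ?_ ?_)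
  · exact Primrec.pair (Primrec.list_tail.comp hL)
      (Primrec.list_cons.comp ((Primrec.list_getD 0).comp hL (Primrec.const 0))
        (Primrec.list_cons.comp ha hR))
  · exact Primrec.pair hL (Primrec.list_cons.comp ha hR)
  · exact Primrec.pair (Primrec.list_cons.comp ha hL) hR

theorem primrec_codeStep : Primrec₂ codeStep := by
  have hh : Primrec fun x : TuringMachine.Code × (ℕ × List ℕ × List ℕ) => x.1.2.2.2.1 :=
    Primrec.fst.comp (Primrec.snd.comp (Primrec.snd.comp (Primrec.snd.comp Primrec.fst)))
  have he : Primrec fun x : TuringMachine.Code × (ℕ × List ℕ × List ℕ) => entry x.1 x.2 :=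
    primrec_entry
  have hx : Primrec fun x : TuringMachine.Code × (ℕ × List ℕ × List ℕ) => x.2.1 :=
    Primrec.fst.comp Primrec.snd
  have hm : Primrec fun x : TuringMachine.Code × (ℕ × List ℕ × List ℕ) =>
      ((entry x.1 x.2).1, moveTape (entry x.1 x.2) x.2.2) :=
    Primrec.pair (Primrec.fst.comp he) (primrec_moveTape.comp he (Primrec.snd.comp Primrec.snd))
  exact Primrec.ite (Primrec.eq.comp hx hh) Primrec.snd hm

theorem primrec_codeRun : Primrec₂ codeRun := by
  have hs : Primrec fun x : (TuringMachine.Code × List ℕ × List ℕ) × ℕ =>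
      (x.1.1.2.2.1, x.1.2) :=
    Primrec.pair (Primrec.fst.comp (Primrec.snd.comp (Primrec.snd.comp
      (Primrec.fst.comp Primrec.fst)))) (Primrec.snd.comp Primrec.fst)
  exact Primrec.nat_iterate Primrec.snd hs
    (primrec_codeStep.comp (Primrec.fst.comp (Primrec.fst.comp Primrec.fst)) Primrec.snd)

theorem primrec_window : Primrec₂ window := by
  have hi : Primrec fun y : ((List ℕ × List ℕ) × ℕ) × ℕ => y.2 := Primrec.snd
  have hk : Primrec fun y : ((List ℕ × List ℕ) × ℕ) × ℕ => y.1.2 / 2 :=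
    Primrec.nat_div.comp (Primrec.snd.comp Primrec.fst) (Primrec.const 2)
  have hL : Primrec fun y : ((List ℕ × List ℕ) × ℕ) × ℕ => y.1.1.1 :=
    Primrec.fst.comp (Primrec.fst.comp Primrec.fst)
  have hR : Primrec fun y : ((List ℕ × List ℕ) × ℕ) × ℕ => y.1.1.2 :=
    Primrec.snd.comp (Primrec.fst.comp Primrec.fst)
  refine Primrec.list_map (Primrec.list_range.comp Primrec.snd) ?_
  exact Primrec.ite (Primrec.nat_le.comp hk hi)
    ((Primrec.list_getD 0).comp hR (Primrec.nat_sub.comp hi hk))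
    ((Primrec.list_getD 0).comp hL
      (Primrec.nat_sub.comp (Primrec.nat_sub.comp hk hi) (Primrec.const 1)))

theorem primrec_quadPair : Primrec₂ quadPair :=
  Primrec.nat_add.comp (Primrec.nat_add.comp
    ((primrec_pow_const 2).comp (Primrec.nat_add.comp Primrec.fst Primrec.snd)) Primrec.fst)
    (Primrec.const 1)

theorem primrec_haltingList : Primrec haltingList := by
  have hrun : Primrec fun y : ℕ × ((TuringMachine.Code × List ℕ × List ℕ) × List ℕ) =>
      codeRun y.2.1 y.1.unpair.2 :=
    primrec_codeRun.comp (Primrec.fst.comp Primrec.snd)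
      (Primrec.snd.comp (Primrec.unpair.comp Primrec.fst))
  have hw : Primrec fun y : ℕ × ((TuringMachine.Code × List ℕ × List ℕ) × List ℕ) => y.2.2 :=
    Primrec.snd.comp Primrec.snd
  have hq : Primrec fun y : ℕ × ((TuringMachine.Code × List ℕ × List ℕ) × List ℕ) =>
      y.2.1.1.2.2.2.1 :=
    Primrec.fst.comp (Primrec.snd.comp (Primrec.snd.comp (Primrec.snd.comp
      (Primrec.fst.comp (Primrec.fst.comp Primrec.snd)))))
  have hp : Primrec fun y : ℕ × ((TuringMachine.Code × List ℕ × List ℕ) × List ℕ) =>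
      quadPair (Encodable.encode y.2.1) (Encodable.encode y.2.2) :=
    primrec_quadPair.comp (Primrec.encode.comp (Primrec.fst.comp Primrec.snd))
      (Primrec.encode.comp hw)
  have hhalt : PrimrecPred fun y : ℕ × ((TuringMachine.Code × List ℕ × List ℕ) × List ℕ) =>
      HaltedWith y.2.1 y.2.2 y.1.unpair.2 :=
    (Primrec.eq.comp (Primrec.fst.comp hrun) hq).and
      (Primrec.eq.comp (primrec_window.comp (Primrec.snd.comp hrun) (Primrec.list_length.comp hw))
        hw)
  have hsome : Primrec₂ fun (i : ℕ) (p : (TuringMachine.Code × List ℕ × List ℕ) × List ℕ) =>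
      haltingEntry i i.unpair.2 p :=
    (Primrec.ite (hhalt.and (Primrec.nat_le.comp hp Primrec.fst)) hp (Primrec.const 0)).of_eq
      fun x => rfl
  exact Primrec.option_getD.comp (Primrec.option_map
    (Primrec.decode.comp (Primrec.fst.comp Primrec.unpair)) hsome) (Primrec.const 0)


/-! ## Turing completeness -/

section Completeness

variable {n : ℕ}

/-! ### Open sets that detect a digit -/

/-- The exponents of the monomial `xⱼ ^ k`. -/
def expo (h : 9 ≤ n) (j : Fin 9) (k : ℕ) : Fin n → ℕ := Pi.single (coord h j) k

theorem prod_pow_expo (h : 9 ≤ n) (x : Fin n → ℝ) (j : Fin 9) (k : ℕ) :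
    ∏ i, x i ^ expo h j k i = x (coord h j) ^ k := by
  rw [Finset.prod_eq_single (coord h j)]
  · simp [expo]
  · intro i _ hi
    simp [expo, Pi.single_eq_of_ne hi]
  · simp

theorem prod_pow_add (x : Fin n → ℝ) (e f : Fin n → ℕ) :
    ∏ i, x i ^ (e + f) i = (∏ i, x i ^ e i) * ∏ i, x i ^ f i := by
  simp [pow_add, Finset.prod_mul_distrib]

/-- The conditions that do not depend on the output word: the clock shows almost a multiple of
`2 π`, and the rotation with frequency `β` is almost at rest. -/
def restConditions (h : 9 ≤ n) : List (RatPolyCode n) :=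
  [[((1, 0, 0), expo h 0 1), ((0, 1, 0), 0)],
    [((1, 0, 0), expo h 2 1)],
    [((1, 0, 0), expo h 6 1)],
    [((1, 0, 0), 0), ((0, 1, 0), expo h 5 1 + expo h 0 4)],
    [((1, 0, 0), expo h 5 1), ((8, 0, 0), expo h 0 1 + expo h 1 1)],
    [((1, 0, 0), expo h 5 1), ((0, 8, 0), expo h 0 1 + expo h 1 1)]]

/-- The upper bound for the digit in the open set that belongs to the number `c`. -/
def upperCondition (h : 9 ≤ n) (c : ℕ) : RatPolyCode n :=
  [((0, 4, 0), expo h 3 1), ((4, 0, 0), expo h 7 2 + expo h 5 1),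
    ((8 * c + 4, 0, 0), expo h 7 1 + expo h 5 1), ((4 * c ^ 2 + 5, 0, 0), expo h 5 1)]

/-- The lower bound for the digit in the open set that belongs to the number `c`. -/
def lowerCondition (h : 9 ≤ n) (c : ℕ) : RatPolyCode n :=
  [((4, 0, 0), expo h 3 1), ((0, 4, 0), expo h 7 2 + expo h 5 1),
    ((0, 8 * c + 4, 0), expo h 7 1 + expo h 5 1), ((0, 4 * c ^ 2 + 3, 0), expo h 5 1)]

/-- The open set that belongs to the number `c`. -/
def digitSet (h : 9 ≤ n) (c : ℕ) : OpenCode n :=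
  [upperCondition h c :: lowerCondition h c :: restConditions h]

/-- Each bound on an absolute value is two polynomial inequalities. The one for the digit is
multiplied by 4 to clear the denominator: `4 * ((m + c) ^ 2 + m + 1) ± 1` has the constant terms `4
* c ^ 2 + 5` and `4 * c ^ 2 + 3`. -/
theorem mem_digitSet (h : 9 ≤ n) (c : ℕ) (x : Fin n → ℝ) :
    x ∈ openVal (digitSet h c) ↔
      (1 < x (coord h 0) ∧ 0 < x (coord h 2) ∧ 0 < x (coord h 6) ∧
        x (coord h 5) * x (coord h 0) ^ 4 < 1 ∧
        |8 * x (coord h 0) * x (coord h 1)| < x (coord h 5)) ∧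
      |x (coord h 3) - ((x (coord h 7) + c) ^ 2 + x (coord h 7) + 1) * x (coord h 5)| <
        x (coord h 5) / 4 := by
  simp only [openVal, digitSet, upperCondition, lowerCondition, restConditions, ratPolyVal, ratVal,
    List.mem_cons, List.not_mem_nil, or_false, exists_eq_left, forall_eq_or_imp, forall_eq,
    Set.mem_ofPred_eq, List.map_cons, List.map_nil, List.sum_cons, List.sum_nil, prod_pow_add,
    prod_pow_expo, Pi.zero_apply, pow_zero, Finset.prod_const_one, pow_one, abs_lt]
  push_cast
  norm_num
  constructor
  · rintro ⟨h1, h2, h3, h4, h5, h6, h7, h8⟩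
    refine ⟨⟨?_, ?_, ?_, ?_, ?_, ?_⟩, ?_, ?_⟩ <;> linarith
  · rintro ⟨⟨h3, h4, h5, h6, h7, h8⟩, h1, h2⟩
    refine ⟨?_, ?_, ?_, ?_, ?_, ?_, ?_, ?_⟩ <;> linarith

theorem primrec_digitSet (h : 9 ≤ n) : Primrec (digitSet h) := by
  have hcons : ∀ (e₁ e₂ e₃ e₄ : Fin n → ℕ) (a₁ a₂ : RatCode) (f₃ f₄ : ℕ → RatCode),
      Primrec f₃ → Primrec f₄ →
      Primrec fun c => ([(a₁, e₁), (a₂, e₂), (f₃ c, e₃), (f₄ c, e₄)] : RatPolyCode n) :=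
    fun e₁ e₂ e₃ e₄ a₁ a₂ f₃ f₄ h₃ h₄ =>
      Primrec.list_cons.comp (Primrec.const _) (Primrec.list_cons.comp (Primrec.const _)
        (Primrec.list_cons.comp (Primrec.pair h₃ (Primrec.const _))
          (Primrec.list_cons.comp (Primrec.pair h₄ (Primrec.const _)) (Primrec.const _))))
  have h8 : Primrec fun c : ℕ => 8 * c + 4 :=
    Primrec.nat_add.comp (Primrec.nat_mul.comp (Primrec.const 8) Primrec.id) (Primrec.const 4)
  have h4 : ∀ b : ℕ, Primrec fun c : ℕ => 4 * c ^ 2 + b := fun b =>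
    Primrec.nat_add.comp (Primrec.nat_mul.comp (Primrec.const 4) (primrec_pow_const 2))
      (Primrec.const b)
  have hu : Primrec (upperCondition h) := hcons _ _ _ _ _ _ _ _
    (Primrec.pair h8 (Primrec.const (0, 0))) (Primrec.pair (h4 5) (Primrec.const (0, 0)))
  have hl : Primrec (lowerCondition h) := hcons _ _ _ _ _ _ _ _
    (Primrec.pair (Primrec.const 0) (Primrec.pair h8 (Primrec.const 0)))
    (Primrec.pair (Primrec.const 0) (Primrec.pair (h4 3) (Primrec.const 0)))
  exact Primrec.list_cons.comp
    (Primrec.list_cons.comp hu (Primrec.list_cons.comp hl (Primrec.const _))) (Primrec.const [])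

theorem primrec_startCode (n : ℕ) : Primrec (startCode n) := by
  have hi : ∀ a : ℕ, PrimrecPred fun x : ℕ × Fin n => (x.2 : ℕ) = a := fun a =>
    Primrec.eq.comp (Primrec.fin_val.comp Primrec.snd) (Primrec.const a)
  have h1 : Primrec fun x : ℕ × Fin n =>
      if (x.2 : ℕ) = 2 ∨ (x.2 : ℕ) = 4 ∨ (x.2 : ℕ) = 6 then 1
      else if (x.2 : ℕ) = 7 then x.1 else 0 :=
    Primrec.ite ((hi 2).or ((hi 4).or (hi 6))) (Primrec.const 1)
      (Primrec.ite (hi 7) Primrec.fst (Primrec.const 0))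
  exact Primrec.fin_curry.2 (Primrec.pair h1 (Primrec.const (0, 0)))

/-- The orbit meets an open set if and only if `haltingList` contains the corresponding number. -/
theorem orbit_inter_digitSet_nonempty_iff (h : 9 ≤ n) {g : ℕ → ℕ} (hg : ∀ i, g i ≤ i + 1)
    (m c : ℕ) (hlate : (∃ i, g i = quadPair m c) → ∃ i, 2 ≤ i ∧ g i = quadPair m c) :
    (orbit (polyField (scanField h (digitReal g) (digitReal fun _ => 1)))
      (pointVal (startCode n m)) ∩ openVal (digitSet h c)).Nonempty ↔ ∃ i, g i = quadPair m c := by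
  have hval : ((m : ℝ) + c) ^ 2 + m + 1 = (quadPair m c : ℕ) := by
    rw [quadPair]
    push_cast
    rfl
  constructor
  · rintro ⟨_, ⟨a, b, γ, h0, hγ0, hγ, τ, hτ, rfl⟩, hx⟩
    rw [mem_digitSet] at hx
    rw [eq_scanCurve h h0 hγ0 hγ hτ (j := 0) (by decide),
      eq_scanCurve h h0 hγ0 hγ hτ (j := 1) (by decide),
      eq_scanCurve h h0 hγ0 hγ hτ (j := 2) (by decide),
      eq_scanCurve h h0 hγ0 hγ hτ (j := 3) (by decide),
      eq_scanCurve h h0 hγ0 hγ hτ (j := 5) (by decide),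
      eq_scanCurve h h0 hγ0 hγ hτ (j := 6) (by decide),
      eq_scanCurve h h0 hγ0 hγ hτ (j := 7) (by decide)] at hx
    obtain ⟨⟨h1, h2, h3, h4, h5⟩, h6⟩ := hx
    change 1 < τ at h1
    obtain ⟨k, hk⟩ := exists_digit_of_small h1 h2 h3 h4 h5
    have h7 := hk g hg
    refine ⟨k + 1, ?_⟩
    change |Real.sin (digitReal g * τ) - (((m : ℝ) + c) ^ 2 + m + 1) *
      Real.sin ((digitReal fun _ => 1) * τ)| < Real.sin ((digitReal fun _ => 1) * τ) / 4 at h6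
    have hpos : 0 < Real.sin ((digitReal fun _ => 1) * τ) := (abs_nonneg _).trans_lt h5
    rw [hval] at h6
    rw [abs_lt] at h6 h7
    -- Both multiples of `sin (β τ)` are within a quarter of it from `sin (α τ)`, so the two
    -- integers differ by less than 1.
    have e1 : (g (k + 1) : ℝ) < quadPair m c + 1 := by nlinarith
    have e2 : (quadPair m c : ℝ) < g (k + 1) + 1 := by nlinarith
    have e1 : g (k + 1) < quadPair m c + 1 := by exact_mod_cast e1
    have e2 : quadPair m c < g (k + 1) + 1 := by exact_mod_cast e2
    omega
  · intro hex
    obtain ⟨i, hi2, hi⟩ := hlate hex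
    obtain ⟨k, rfl⟩ : ∃ k, i = k + 1 := ⟨i - 1, by omega⟩
    obtain ⟨t, ht⟩ : ∃ t, t = 2 * Real.pi * scale k := ⟨_, rfl⟩
    obtain ⟨h1, h2, h3, h4, h5, h6, h7⟩ := digit_of_scale (by omega) ht
    refine ⟨scanCurve n (digitReal g) (digitReal fun _ => 1) m t,
      ⟨-1, t + 1, scanCurve n (digitReal g) (digitReal fun _ => 1) m, ⟨by norm_num, by linarith⟩,
        scanCurve_zero _ _ _ _,
        fun s _ => (hasDerivAt_scanCurve h _ _ m s).hasDerivWithinAt,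
        t, ⟨by linarith, by linarith⟩, rfl⟩, ?_⟩
    rw [mem_digitSet]
    refine ⟨⟨h1, ?_, h4, h6, ?_⟩, ?_⟩
    · change 0 < Real.cos t
      rw [h2]
      exact one_pos
    · change |8 * t * Real.sin t| < Real.sin ((digitReal fun _ => 1) * t)
      rw [h3, mul_zero, abs_zero]
      exact h5
    · change |Real.sin (digitReal g * t) - (((m : ℝ) + c) ^ 2 + m + 1) *
        Real.sin ((digitReal fun _ => 1) * t)| < Real.sin ((digitReal fun _ => 1) * t) / 4
      rw [hval, ← hi]
      exact h7 g hg

theorem haltsWith_iff (T : TuringMachine) (L R : List (Fin T.symbols)) (k : ℕ)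
    (w : Fin (2 * k + 1) → Fin T.symbols) :
    T.HaltsWith (T.tapeOf L R) k w ↔
      ∃ j, HaltedWith (T.code, wordCode L, wordCode R) (wordCode (List.ofFn w)) j :=
  exists_congr fun j => (haltedWith_iff T L R k w j).symm

/-- The vector field whose frequency `α` lists the halting computations is Turing complete. -/
theorem isTuringComplete_scanField (h : 9 ≤ n) :
    IsTuringComplete (polyField
      (scanField h (digitReal haltingList) (digitReal fun _ => 1))) := by
  refine ⟨fun d => startCode n (Encodable.encode d), fun w => digitSet h (Encodable.encode w),
    ((primrec_startCode n).comp Primrec.encode).to_comp,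
    ((primrec_digitSet h).comp Primrec.encode).to_comp, fun k T L R w => ?_⟩
  have hlate : (∃ i, haltingList i = quadPair
      (Encodable.encode (T.code, wordCode L, wordCode R))
      (Encodable.encode (wordCode (List.ofFn w)))) → ∃ i, 2 ≤ i ∧ haltingList i = quadPair
      (Encodable.encode (T.code, wordCode L, wordCode R))
      (Encodable.encode (wordCode (List.ofFn w))) := fun ⟨i, hi⟩ => by
    obtain ⟨j, hj⟩ := exists_haltedWith hi
    exact exists_haltingList_eq hj
  rw [orbit_inter_digitSet_nonempty_iff h (fun i => (haltingList_le i).trans (Nat.le_succ i)) _ _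
    hlate, haltsWith_iff]
  constructor
  · rintro ⟨i, hi⟩
    exact exists_haltedWith hi
  · rintro ⟨j, hj⟩
    obtain ⟨i, -, hi⟩ := exists_haltingList_eq hj
    exact ⟨i, hi⟩

end Completeness

end TuringODE

theorem corollary3p3 (n : ℕ) (hn : 17 ≤ n) :
    ∃ P : Fin n → MvPolynomial (Fin n) ℝ,
      TuringODE.fieldDegree P = 56 ∧
      TuringODE.IsConstructible P ∧
      TuringODE.IsTuringComplete (TuringODE.polyField P) := by
  -- Nine coordinates suffice; the field vanishes in the others.
  have h : 9 ≤ n := by omega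
  refine ⟨TuringODE.scanField h (TuringODE.digitReal TuringODE.haltingList)
    (TuringODE.digitReal fun _ => 1), TuringODE.fieldDegree_scanField h _ _, ?_,
    TuringODE.isTuringComplete_scanField h⟩
  exact TuringODE.isConstructible_scanField h
    (TuringODE.isComputableReal_digitReal
      (fun i => (TuringODE.haltingList_le i).trans (Nat.le_succ i))
      TuringODE.primrec_haltingList.to_comp)
    (TuringODE.isComputableReal_digitReal (fun i => Nat.le_add_left 1 i) (Computable.const 1))
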